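/- Let $H=L^2(S^1,\mathbb C)$ with orthonormal basis $z^n$, $n\in\mathbb Z$, and let $H_+$ be the closed span of the $z^n$, $n\ge 0$. Let $Gr_1$ be the set of closed subspaces $W\subset H$ such that $pH_+\subset W\subset q^{-1}H_+$ for some non-zero polynomials $p,q\in\mathbb C[z]$. Let $\Gamma_+$ be the group of functions $S^1\to\mathbb C^\times$ that extend to non-vanishing holomorphic functions $f$ on $\{|z|\le 1\}$ with $f(0)=1$, and $\Gamma_-$ the group of those that extend to non-vanishing holomorphic functions $f$ on $\{|z|\ge1\}\cup\{\infty\}$ with $f(\infty)=1$; both act on closed subspaces of $H$ by multiplication. For $W\in Gr_1$ let $W^{alg}$ be the set of elements of $W$ with only finitely many positive powers of $z$, and $A_W$ the ring of continuous functions $f$ on $S^1$ with $fW^{alg}\subset W^{alg}$. The spectral curve $X_W$ is the complete rational curve $\operatorname{Spec}A_W\cup\{\infty\}$, with normalization $\mathbb P^1$ (coordinate $z$) and with $\infty$ a smooth point. Its generalized Jacobian $\operatorname{Jac}(X_W)$ is the group of divisors of degree $0$ on the smooth locus of $X_W$ modulo the divisors of those rational functions that are units in the local rings of all singular points (equivalently,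 the group of line bundles of degree $0$), with its structure of algebraic group, in which the divisor class of an algebraic family of divisors on the smooth locus depends algebraically on the parameters. **Proposition.** Let $W\in Gr_1$. 1. If $g\in\Gamma_-$ and $g\neq1$, then $gW$ is not in the $\Gamma_+$-orbit of $W$. 2. $A_W$ consists of polynomials in $z$. 3. The orbit $\Gamma_+W$ (without any quotient by $\Gamma_-$) is isomorphic to $\operatorname{Jac}(X_W)$: there is a bijection $\Phi:\Gamma_+W\to\operatorname{Jac}(X_W)$ which satisfies $\Phi(ghW)=\Phi(gW)+\Phi(hW)$ for all $g,h\in\Gamma_+$, and which is an isomorphism of algebraic varieties and of complex manifolds, where the structures on $\Gamma_+W$ are those induced from the Grassmannian of closed subspaces of $H$. That is, for every $n$ and every $T\subset\mathbb C^n$, a map $F:T\to\Gamma_+W$ is a regular map to the Grassmannian if and only if $\Phi\circ F$ is a regular map to $\operatorname{Jac}(X_W)$, and, for $T$ open, $F$ is holomorphic if and only if $\Phi\circ F$ is holomorphic. -/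

import Mathlib

open MeasureTheory Polynomial Topology
open scoped ENNReal

noncomputable section

namespace KPOrbit

/-! ### The Hilbert space `H = L²(S¹)` and multiplication operators -/

/-- The circle `S¹`, parametrised by `θ ∈ ℝ/ℤ` through `z = exp (2πiθ)`; the coordinate function
`z` is `fourier 1`, and `z ^ n` is `fourier n`. -/
abbrev S1 : Type := UnitAddCircle

/-- The Hilbert space `H = L²(S¹, ℂ)`, with orthonormal basis `z ^ n`, `n ∈ ℤ`. -/
abbrev H : Type := Lp ℂ 2 (AddCircle.haarAddCircle : Measure S1)

/-- The coefficient of `z ^ n` in an element of `H`. -/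
def coeffH (v : H) (n : ℤ) : ℂ := (fourierBasis.repr v : ℤ → ℂ) n

@[simp] theorem coeffH_zero (n : ℤ) : coeffH 0 n = 0 := by simp [coeffH]

@[simp] theorem coeffH_add (v w : H) (n : ℤ) :
    coeffH (v + w) n = coeffH v n + coeffH w n := by simp [coeffH]

@[simp] theorem coeffH_smul (c : ℂ) (v : H) (n : ℤ) :
    coeffH (c • v) n = c * coeffH v n := by simp [coeffH]

/-- `H₊`: the closed span of the non-negative powers of `z`. -/
def Hplus : Submodule ℂ H where
  carrier := {v | ∀ n < 0, coeffH v n = 0}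
  zero_mem' := by intro n _; simp
  add_mem' := by intro v w hv hw n hn; simp [hv n hn, hw n hn]
  smul_mem' := by intro c v hv n hn; simp [hv n hn]

/-- The operator of multiplication by a continuous function on `H`. -/
def mulOp (f : C(S1, ℂ)) : H →L[ℂ] H :=
  (ContinuousLinearMap.mul ℂ ℂ).holderL AddCircle.haarAddCircle ∞ 2 2
    (ContinuousMap.toLp ∞ AddCircle.haarAddCircle ℂ f)

theorem mulOp_ae (f : C(S1, ℂ)) (v : H) :
    (mulOp f v : S1 → ℂ) =ᵐ[AddCircle.haarAddCircle] fun θ => f θ * v θ := by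
  have h1 := ContinuousLinearMap.coeFn_holder (r := 2) (ContinuousLinearMap.mul ℂ ℂ)
    (ContinuousMap.toLp ∞ AddCircle.haarAddCircle ℂ f) v
  have h2 := ContinuousMap.coeFn_toLp (p := ∞) (𝕜 := ℂ)
    (AddCircle.haarAddCircle : Measure S1) f
  filter_upwards [h1, h2] with θ h1 h2
  rw [mulOp, ContinuousLinearMap.holderL_apply_apply, h1, h2]
  simp

theorem mulOp_one : mulOp 1 = ContinuousLinearMap.id ℂ H := by
  ext1 v
  apply Lp.ext
  filter_upwards [mulOp_ae 1 v] with θ h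
  simp [h]

theorem mulOp_mul (f g : C(S1, ℂ)) (v : H) : mulOp (f * g) v = mulOp f (mulOp g v) := by
  apply Lp.ext
  filter_upwards [mulOp_ae (f * g) v, mulOp_ae f (mulOp g v), mulOp_ae g v] with θ h1 h2 h3
  rw [h1, h2, h3, ContinuousMap.mul_apply, mul_assoc]

theorem mulOp_add (f g : C(S1, ℂ)) : mulOp (f + g) = mulOp f + mulOp g := by
  simp [mulOp]

theorem mulOp_smul (c : ℂ) (f : C(S1, ℂ)) : mulOp (c • f) = c • mulOp f := by
  simp [mulOp]

/-- A polynomial in `z`, as a function on the circle. -/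
def polyS1 : ℂ[X] →ₐ[ℂ] C(S1, ℂ) := aeval (fourier 1)

/-! ### The Grassmannian, its subset `Gr₁`, and the groups `Γ₊` and `Γ₋` -/

/-- Points are closed subspaces of `H`. -/
abbrev Gr : Type := ClosedSubmodule ℂ H

/-- `W ∈ Gr₁`: there are non-zero polynomials `p`, `q` with `p H₊ ⊆ W ⊆ q⁻¹ H₊`. (Such a `W`
is automatically commensurable with `H₊`; no condition is put on its virtual dimension.) -/
def InGr1 (W : Gr) : Prop :=
  ∃ p q : ℂ[X], p ≠ 0 ∧ q ≠ 0 ∧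
    (∀ v ∈ Hplus, mulOp (polyS1 p) v ∈ W) ∧ (∀ w ∈ W, mulOp (polyS1 q) w ∈ Hplus)

/-- Invertible functions on the circle act on closed subspaces by `g • W = {g w | w ∈ W}`. -/
instance : MulAction C(S1, ℂ)ˣ Gr where
  smul g W := W.comap (mulOp ((g⁻¹ : C(S1, ℂ)ˣ) : C(S1, ℂ)))
  one_smul W := by
    ext v
    change mulOp ((1⁻¹ : C(S1, ℂ)ˣ) : C(S1, ℂ)) v ∈ W ↔ v ∈ W
    simp [mulOp_one]
  mul_smul g h W := by
    ext v
    change mulOp (((g * h)⁻¹ : C(S1, ℂ)ˣ) : C(S1, ℂ)) v ∈ W ↔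
      mulOp ((h⁻¹ : C(S1, ℂ)ˣ) : C(S1, ℂ)) (mulOp ((g⁻¹ : C(S1, ℂ)ˣ) : C(S1, ℂ)) v) ∈ W
    rw [← mulOp_mul, mul_inv_rev, Units.val_mul]

theorem mem_smul_iff (g : C(S1, ℂ)ˣ) (W : Gr) (v : H) :
    v ∈ g • W ↔ ∃ w ∈ W, v = mulOp (g : C(S1, ℂ)) w := by
  change mulOp ((g⁻¹ : C(S1, ℂ)ˣ) : C(S1, ℂ)) v ∈ W ↔ _
  constructor
  · intro h
    refine ⟨_, h, ?_⟩
    rw [← mulOp_mul, Units.mul_inv, mulOp_one]; rfl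
  · rintro ⟨w, hw, rfl⟩
    rw [← mulOp_mul, Units.inv_mul, mulOp_one]; exact hw

/-- `f` is holomorphic and non-vanishing on (a neighbourhood of) the closed unit disc and
`f 0 = 1`. -/
def IsDiscUnit (f : ℂ → ℂ) : Prop :=
  AnalyticOnNhd ℂ f (Metric.closedBall 0 1) ∧ (∀ z ∈ Metric.closedBall (0 : ℂ) 1, f z ≠ 0) ∧
    f 0 = 1

theorem IsDiscUnit.one : IsDiscUnit 1 := ⟨fun _ _ => analyticAt_const, by simp, rfl⟩

theorem IsDiscUnit.mul {f g : ℂ → ℂ} (hf : IsDiscUnit f) (hg : IsDiscUnit g) :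
    IsDiscUnit (f * g) :=
  ⟨hf.1.mul hg.1, fun z hz => mul_ne_zero (hf.2.1 z hz) (hg.2.1 z hz),
    by simp [hf.2.2, hg.2.2]⟩

theorem IsDiscUnit.inv {f : ℂ → ℂ} (hf : IsDiscUnit f) : IsDiscUnit f⁻¹ :=
  ⟨hf.1.inv hf.2.1, fun z hz => inv_ne_zero (hf.2.1 z hz), by simp [hf.2.2]⟩

theorem units_inv_apply (g : C(S1, ℂ)ˣ) (θ : S1) :
    ((g⁻¹ : C(S1, ℂ)ˣ) : C(S1, ℂ)) θ = ((g : C(S1, ℂ)) θ)⁻¹ := by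
  apply eq_inv_of_mul_eq_one_left
  rw [← ContinuousMap.mul_apply, Units.inv_mul]; rfl

/-- `Γ₊`: functions `S¹ → ℂˣ` which extend to non-vanishing holomorphic functions on
`{|z| ≤ 1}` with value `1` at `0`. -/
def GammaPlus : Subgroup C(S1, ℂ)ˣ where
  carrier := {g | ∃ f : ℂ → ℂ, IsDiscUnit f ∧ ∀ θ, (g : C(S1, ℂ)) θ = f (fourier 1 θ)}
  one_mem' := ⟨1, .one, fun _ => rfl⟩
  mul_mem' := by
    rintro g h ⟨f, hf, hg⟩ ⟨k, hk, hh⟩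
    exact ⟨f * k, hf.mul hk, fun θ => by simp [hg, hh]⟩
  inv_mem' := by
    rintro g ⟨f, hf, hg⟩
    exact ⟨f⁻¹, hf.inv, fun θ => by rw [units_inv_apply, hg]; rfl⟩

/-- `Γ₋`: functions `S¹ → ℂˣ` which extend to non-vanishing holomorphic functions on
`{|z| ≥ 1} ∪ {∞}` with value `1` at `∞`, i.e. which are of the form `f (1 / z)` with `f`
non-vanishing and holomorphic on `{|z| ≤ 1}` and `f 0 = 1`. -/
def GammaMinus : Subgroup C(S1, ℂ)ˣ where
  carrier := {g | ∃ f : ℂ → ℂ, IsDiscUnit f ∧ ∀ θ, (g : C(S1, ℂ)) θ = f ((fourier 1 θ)⁻¹)}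
  one_mem' := ⟨1, .one, fun _ => rfl⟩
  mul_mem' := by
    rintro g h ⟨f, hf, hg⟩ ⟨k, hk, hh⟩
    exact ⟨f * k, hf.mul hk, fun θ => by simp [hg, hh]⟩
  inv_mem' := by
    rintro g ⟨f, hf, hg⟩
    exact ⟨f⁻¹, hf.inv, fun θ => by rw [units_inv_apply, hg]; rfl⟩

/-! ### The spectral curve -/

/-- The elements of `W` of finite order, i.e. with only finitely many positive powers of `z`. -/
def algPart (W : Gr) : Submodule ℂ H where
  carrier := {w | w ∈ W ∧ ∃ N : ℤ, ∀ n > N, coeffH w n = 0}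
  zero_mem' := ⟨zero_mem W, 0, by simp⟩
  add_mem' := by
    rintro v w ⟨hv, M, hM⟩ ⟨hw, N, hN⟩
    refine ⟨add_mem hv hw, max M N, fun n hn => ?_⟩
    rw [coeffH_add, hM n (lt_of_le_of_lt (le_max_left _ _) hn),
      hN n (lt_of_le_of_lt (le_max_right _ _) hn), add_zero]
  smul_mem' := by
    rintro c v ⟨hv, M, hM⟩
    exact ⟨W.smul_mem c hv, M, fun n hn => by rw [coeffH_smul, hM n hn, mul_zero]⟩

/-- The ring `A_W` of all functions `f` on the circle with `f W_alg ⊆ W_alg`. -/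
def multiplierRing (W : Gr) : Subalgebra ℂ C(S1, ℂ) where
  carrier := {f | ∀ w ∈ algPart W, mulOp f w ∈ algPart W}
  mul_mem' := by
    intro f g hf hg w hw
    rw [mulOp_mul]; exact hf _ (hg _ hw)
  add_mem' := by
    intro f g hf hg w hw
    rw [mulOp_add]; exact add_mem (hf _ hw) (hg _ hw)
  algebraMap_mem' := by
    intro c w hw
    rw [Algebra.algebraMap_eq_smul_one, mulOp_smul, mulOp_one]
    exact Submodule.smul_mem _ c hw

/-- The polynomials in `z` which belong to `A_W`. For `W ∈ Gr₁` this is all of `A_W`, it is the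
coordinate ring of the affine part of the spectral curve `X`, a complete rational curve which
has one more, smooth, point `z = ∞`; the normalisation of `X` is the projective line with
coordinate `z`. -/
def spectralRing (W : Gr) : Subalgebra ℂ ℂ[X] := (multiplierRing W).comap polyS1

/-! ### The generalized Jacobian of a rational curve

`A ⊆ ℂ[z]` is the coordinate ring of the affine curve `X ∖ {∞}`, with normalisation
`ℂ[z]`. -/

/-- The `c ∈ ℂ` lying over a singular point of `X`: those at which the local ring
of `X` does not contain `ℂ[z]`, i.e. the common zeros of the conductor
`{b ∈ A | b ℂ[z] ⊆ A}`. -/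
def singularSet (A : Subalgebra ℂ ℂ[X]) : Set ℂ :=
  {c | ∀ b ∈ A, (∀ f : ℂ[X], b * f ∈ A) → b.eval c = 0}

/-- The divisors of degree zero supported on the smooth locus `ℙ¹ ∖ singularSet A` of `X`. -/
def divZero (A : Subalgebra ℂ ℂ[X]) : AddSubgroup (OnePoint ℂ →₀ ℤ) where
  carrier := {D | (∀ c ∈ singularSet A, D (c : OnePoint ℂ) = 0) ∧ (D.sum fun _ n => n) = 0}
  zero_mem' := by simp
  add_mem' := by
    rintro D E ⟨hD, hD'⟩ ⟨hE, hE'⟩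
    refine ⟨fun c hc => by simp [hD c hc, hE c hc], ?_⟩
    rw [Finsupp.sum_add_index' (by simp) (by simp), hD', hE', add_zero]
  neg_mem' := by
    rintro D ⟨hD, hD'⟩
    refine ⟨fun c hc => by simp [hD c hc], ?_⟩
    rw [Finsupp.sum_neg_index (by simp)]
    simpa [Finsupp.sum] using hD'

/-- The divisor on `ℙ¹` of a non-zero polynomial. -/
def polyDiv (f : ℂ[X]) : OnePoint ℂ →₀ ℤ :=
  (f.roots.map fun c : ℂ => Finsupp.single (c : OnePoint ℂ) (1 : ℤ)).sum -
    Finsupp.single OnePoint.infty (f.natDegree : ℤ)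

theorem polyDiv_mul {f g : ℂ[X]} (hf : f ≠ 0) (hg : g ≠ 0) :
    polyDiv (f * g) = polyDiv f + polyDiv g := by
  rw [polyDiv, polyDiv, polyDiv, roots_mul (mul_ne_zero hf hg), natDegree_mul hf hg,
    Multiset.map_add, Multiset.sum_add, Nat.cast_add, Finsupp.single_add]
  abel

/-- `f` is a non-zero element of `A` which does not vanish at any singular point. -/
def IsSingUnit (A : Subalgebra ℂ ℂ[X]) (f : ℂ[X]) : Prop :=
  f ∈ A ∧ f ≠ 0 ∧ ∀ c ∈ singularSet A, f.eval c ≠ 0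

theorem IsSingUnit.mul {A : Subalgebra ℂ ℂ[X]} {f g : ℂ[X]} (hf : IsSingUnit A f)
    (hg : IsSingUnit A g) : IsSingUnit A (f * g) :=
  ⟨A.mul_mem hf.1 hg.1, mul_ne_zero hf.2.1 hg.2.1, fun c hc => by
    rw [eval_mul]; exact mul_ne_zero (hf.2.2 c hc) (hg.2.2 c hc)⟩

/-- The divisors of the rational functions on `X` that are units in the local rings of all the
singular points, i.e. of the units of the semi-local ring
`{a / b | a, b ∈ A, b has no zero at a singular point}`. -/
def principalDiv (A : Subalgebra ℂ ℂ[X]) : AddSubgroup (OnePoint ℂ →₀ ℤ) where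
  carrier := {D | ∃ a b : ℂ[X], IsSingUnit A a ∧ IsSingUnit A b ∧ D = polyDiv a - polyDiv b}
  zero_mem' := by
    have h : IsSingUnit A 1 := ⟨A.one_mem, one_ne_zero, by simp⟩
    exact ⟨1, 1, h, h, by simp⟩
  add_mem' := by
    rintro _ _ ⟨a, b, ha, hb, rfl⟩ ⟨a', b', ha', hb', rfl⟩
    refine ⟨a * a', b * b', ha.mul ha', hb.mul hb', ?_⟩
    rw [polyDiv_mul ha.2.1 ha'.2.1, polyDiv_mul hb.2.1 hb'.2.1]
    abel
  neg_mem' := by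
    rintro _ ⟨a, b, ha, hb, rfl⟩
    exact ⟨b, a, hb, ha, by abel⟩

/-- The generalized Jacobian of `X`: divisors of degree zero on the smooth locus, modulo the
divisors of the rational functions that are units at the singular points. (This is the group of
isomorphism classes of line bundles of degree zero on `X`.) -/
abbrev GenJacobian (A : Subalgebra ℂ ℂ[X]) : Type :=
  divZero A ⧸ (principalDiv A).addSubgroupOf (divZero A)

/-- `x` is the class of `(zeros of u) - N ∞`, where the polynomial `u ≠ 0` of degree at most `N`
is seen as a section of `𝒪(N)` on `ℙ¹`; the zeros are required to be smooth points of `X`. -/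
def IsZeroClass (A : Subalgebra ℂ ℂ[X]) (u : ℂ[X]) (x : GenJacobian A) : Prop :=
  u ≠ 0 ∧ ∃ h : polyDiv u ∈ divZero A, x = QuotientAddGroup.mk ⟨polyDiv u, h⟩

/-! ### Algebraic and holomorphic families of points of `Gr` and of the Jacobian

The structures of algebraic variety and of complex manifold are expressed through the maps
into the space: which maps `T → Gr`, `T → GenJacobian A` from an algebraic
variety `T ⊆ ℂⁿ` are morphisms, and which maps from an open set `T ⊆ ℂⁿ` are holomorphic. -/

/-- `V` is the graph of `B : W → Wᗮ`; such `V` form the standard affine chart of the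
Grassmannian around `W`. -/
def IsGraph (V W : Gr) (B : W.toSubmodule →L[ℂ] (W.toSubmodule)ᗮ) : Prop :=
  ∀ v : H, v ∈ V ↔ ∃ w : W.toSubmodule, v = (w : H) + (B w : H)

/-- `F : T → Gr` is a regular map: locally in the Zariski topology, in the chart around `F t₀`, it
is given by finitely many rational functions. -/
def IsRegularGr {n : ℕ} {T : Set (Fin n → ℂ)} (F : T → Gr) : Prop :=
  ∀ t₀ : T, ∃ (m : ℕ) (B : Fin m → ((F t₀).toSubmodule →L[ℂ] ((F t₀).toSubmodule)ᗮ))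
    (P : Fin m → MvPolynomial (Fin n) ℂ) (Q : MvPolynomial (Fin n) ℂ),
    MvPolynomial.eval t₀.1 Q ≠ 0 ∧ ∀ t : T, MvPolynomial.eval t.1 Q ≠ 0 →
      IsGraph (F t) (F t₀)
        (∑ i, (MvPolynomial.eval t.1 (P i) / MvPolynomial.eval t.1 Q) • B i)

/-- `F : T → Gr` is a holomorphic map: in the chart around `F t₀` it is given by an
operator-valued holomorphic function. -/
def IsHolomorphicGr {n : ℕ} {T : Set (Fin n → ℂ)} (F : T → Gr) : Prop :=
  ∀ t₀ : T, ∃ B : (Fin n → ℂ) → ((F t₀).toSubmodule →L[ℂ] ((F t₀).toSubmodule)ᗮ),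
    AnalyticAt ℂ B t₀.1 ∧
      ∀ᶠ t in 𝓝 t₀.1, ∀ ht : t ∈ T, IsGraph (F ⟨t, ht⟩) (F t₀) (B t)

/-- `F : T → GenJacobian A` is a regular map: locally in the Zariski topology, it is the divisor
class of an algebraic family of effective divisors on the smooth locus of `X` (minus a multiple of
`∞`), given by the zeros of a polynomial in `z` whose coefficients are rational functions. -/
def IsRegularJac {A : Subalgebra ℂ ℂ[X]} {n : ℕ} {T : Set (Fin n → ℂ)}
    (F : T → GenJacobian A) : Prop :=
  ∀ t₀ : T, ∃ (N : ℕ) (P : Fin (N + 1) → MvPolynomial (Fin n) ℂ) (Q : MvPolynomial (Fin n) ℂ),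
    MvPolynomial.eval t₀.1 Q ≠ 0 ∧ ∀ t : T, MvPolynomial.eval t.1 Q ≠ 0 →
      IsZeroClass A
        (∑ i, C (MvPolynomial.eval t.1 (P i) / MvPolynomial.eval t.1 Q) * X ^ (i : ℕ)) (F t)

/-- `F : T → GenJacobian A` is a holomorphic map: locally it is the divisor class of a
holomorphic family of effective divisors on the smooth locus of `X` (minus a multiple of `∞`). -/
def IsHolomorphicJac {A : Subalgebra ℂ ℂ[X]} {n : ℕ} {T : Set (Fin n → ℂ)}
    (F : T → GenJacobian A) : Prop :=
  ∀ t₀ : T, ∃ (N : ℕ) (a : Fin (N + 1) → (Fin n → ℂ) → ℂ), (∀ i, AnalyticAt ℂ (a i) t₀.1) ∧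
    ∀ᶠ t in 𝓝 t₀.1, ∀ ht : t ∈ T,
      IsZeroClass A (∑ i, C (a i t) * X ^ (i : ℕ)) (F ⟨t, ht⟩)

end KPOrbit

end

/-! Put `m = p * q`. Linear factors of `p` and `q` with a root of modulus at least 1 can be dropped,
because the coefficients of an element of `H` tend to zero; so all roots of `m` may be taken in the
open disc, and `m` is invertible on the circle. If `f` preserves `H₊`, then `m f W ⊆ p H₊ ⊆ W`.
Hence the action on `W` modulo `p H₊` of the algebra `discAlgebra` of such `f` depends only on `f`
modulo `m`, and division with remainder in `H₊` identifies these residues with `ℂ[z]/(m)`. The same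
`p` and `q` serve the whole `Γ₊`-orbit.

Parts 1 and 2 rest on `eq_polyS1_of_forall_pow`: if `f ^ n * m` is a polynomial for every `n`, then
`f` is a polynomial, since its powers have bounded denominators. This applies to every `f` in `A_W`,
and to every `g` in `Γ₋` such that `g W` lies in the `Γ₊`-orbit; in the latter case `g` has no
positive powers of `z` and constant term 1, so `g = 1`.

For part 3, send `g` in `Γ₊` with `g ≡ u` modulo `m` to the class of the zeros of `u`. The conductor
of `A = spectralRing W` is generated by a divisor `m₀` of `m`. The class of a polynomial prime to
`m₀` depends only on its residue modulo `m₀`, and vanishes exactly when the polynomial is in `A`. As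
`g W = W` is also equivalent to `u ∈ A`, the map descends to an injection on the orbit. It is
surjective because exponentials of polynomials realise every unit modulo `m` up to a constant
(`exists_GammaPlus_eq`).

The regular and the holomorphic comparison are the same argument over a local algebra `R` of
functions of the parameter. A family of polynomials over `R` equal to 1 at the base point moves `V`
to `u V + p H₊`, a graph over `V` obtained by inverting a Gram matrix over `R`
(`Between.exists_graph`). Conversely, for a family of graphs `V'`, the condition `u V ⊆ V'` is a
linear system over `R` for `u` of degree less than `deg m`. On the orbit the dimension of its
solution space is never below that at the base point, so Cramer's rule extends the solution `u = 1`
to a family over `R` (`Between.exists_multiplier`). -/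

namespace KPOrbit

/-! ### Fourier coefficients and multiplication operators -/

/-- A continuous function on the circle, as an element of `H`. -/
noncomputable abbrev ofC : C(S1, ℂ) →L[ℂ] H :=
  ContinuousMap.toLp 2 (AddCircle.haarAddCircle : Measure S1) ℂ

theorem coeffH_eq_inner (v : H) (n : ℤ) : coeffH v n = inner ℂ (ofC (fourier n)) v := by
  rw [coeffH, HilbertBasis.repr_apply_apply, coe_fourierBasis]

theorem coeffH_eq_fourierCoeff (v : H) (n : ℤ) : coeffH v n = fourierCoeff v n := by
  rw [coeffH, fourierBasis_repr]

theorem coeffH_ofC (f : C(S1, ℂ)) (n : ℤ) : coeffH (ofC f) n = fourierCoeff f n := by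
  rw [coeffH_eq_fourierCoeff, fourierCoeff_toLp]

@[simp] theorem coeffH_sub (v w : H) (n : ℤ) :
    coeffH (v - w) n = coeffH v n - coeffH w n := by
  simp [coeffH_eq_inner, inner_sub_right]

theorem coeffH_ext {v w : H} (h : ∀ n, coeffH v n = coeffH w n) : v = w := by
  apply fourierBasis.repr.injective
  ext n
  exact h n

theorem coeffH_fourier (k n : ℤ) :
    coeffH (ofC (fourier k)) n = if n = k then 1 else 0 := by
  have h := orthonormal_iff_ite.1 (orthonormal_fourier (T := 1)) n k
  rw [coeffH_eq_inner]
  exact h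

theorem mulOp_ofC (f g : C(S1, ℂ)) : mulOp f (ofC g) = ofC (f * g) := by
  apply Lp.ext
  filter_upwards [mulOp_ae f (ofC g), ContinuousMap.coeFn_toLp (p := 2) (𝕜 := ℂ)
    (AddCircle.haarAddCircle : Measure S1) g, ContinuousMap.coeFn_toLp (p := 2) (𝕜 := ℂ)
    (AddCircle.haarAddCircle : Measure S1) (f * g)] with θ h1 h2 h3
  rw [h1, h2, h3]; rfl

theorem ofC_eq_mulOp (f : C(S1, ℂ)) : ofC f = mulOp f (ofC 1) := by
  rw [mulOp_ofC, mul_one]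

theorem ofC_injective : Function.Injective ofC :=
  ContinuousMap.toLp_injective (AddCircle.haarAddCircle : Measure S1)

theorem coeffH_mulOp_fourier (k : ℤ) (v : H) (n : ℤ) :
    coeffH (mulOp (fourier k) v) n = coeffH v (n - k) := by
  rw [coeffH_eq_fourierCoeff, coeffH_eq_fourierCoeff, fourierCoeff, fourierCoeff]
  apply integral_congr_ae
  filter_upwards [mulOp_ae (fourier k) v] with θ h
  rw [h, smul_eq_mul, smul_eq_mul, ← mul_assoc, ← fourier_add, neg_sub, neg_add_eq_sub]

theorem mulOp_comm (f g : C(S1, ℂ)) (v : H) : mulOp f (mulOp g v) = mulOp g (mulOp f v) := by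
  rw [← mulOp_mul, mul_comm, mulOp_mul]

theorem mulOp_sub (f g : C(S1, ℂ)) : mulOp (f - g) = mulOp f - mulOp g := by
  rw [eq_sub_iff_add_eq, ← mulOp_add, sub_add_cancel]

theorem mulOp_add_apply (f g : C(S1, ℂ)) (v : H) :
    mulOp (f + g) v = mulOp f v + mulOp g v := by rw [mulOp_add]; rfl

theorem mulOp_sub_apply (f g : C(S1, ℂ)) (v : H) :
    mulOp (f - g) v = mulOp f v - mulOp g v := by rw [mulOp_sub]; rfl

theorem mulOp_smul_apply (c : ℂ) (f : C(S1, ℂ)) (v : H) :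
    mulOp (c • f) v = c • mulOp f v := by rw [mulOp_smul]; rfl

theorem mulOp_one_apply (v : H) : mulOp 1 v = v := by rw [mulOp_one]; rfl

theorem polyS1_X : polyS1 X = fourier 1 := by simp [polyS1]

theorem polyS1_C (c : ℂ) : polyS1 (C c) = c • (1 : C(S1, ℂ)) := by
  rw [polyS1, aeval_C, Algebra.algebraMap_eq_smul_one]

theorem polyS1_apply (u : ℂ[X]) (θ : S1) : polyS1 u θ = u.eval (fourier 1 θ) := by
  induction u using Polynomial.induction_on' with
  | add p q hp hq => simp [hp, hq]
  | monomial n a =>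
    rw [← C_mul_X_pow_eq_monomial, map_mul, polyS1_C, map_pow, polyS1_X]
    simp

theorem fourier_one_pow (n : ℕ) : (fourier 1 : C(S1, ℂ)) ^ n = fourier (n : ℤ) := by
  induction n with
  | zero => ext; simp
  | succ n ih =>
    ext θ
    rw [pow_succ, ih]
    simp only [ContinuousMap.mul_apply]
    rw [← fourier_add]; push_cast; rfl

theorem mulOp_C (c : ℂ) (v : H) : mulOp (polyS1 (C c)) v = c • v := by
  rw [polyS1_C, mulOp_smul_apply, mulOp_one_apply]

theorem coeffH_X_sub_C (c : ℂ) (v : H) (n : ℤ) :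
    coeffH (mulOp (polyS1 (X - C c)) v) n = coeffH v (n - 1) - c * coeffH v n := by
  rw [map_sub, mulOp_sub_apply, mulOp_C, polyS1_X, coeffH_sub, coeffH_mulOp_fourier,
    coeffH_smul]

theorem polyS1_monomial (n : ℕ) : polyS1 (X ^ n) = fourier (n : ℤ) := by
  rw [map_pow, polyS1_X, fourier_one_pow]

theorem coeffH_poly (u : ℂ[X]) (n : ℕ) : coeffH (ofC (polyS1 u)) n = u.coeff n := by
  induction u using Polynomial.induction_on' with
  | add p q hp hq => rw [map_add, map_add, coeffH_add, hp, hq, coeff_add]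
  | monomial k a =>
    rw [← C_mul_X_pow_eq_monomial, map_mul, polyS1_C, polyS1_monomial, smul_mul_assoc, one_mul,
      map_smul, coeffH_smul, coeffH_fourier, coeff_C_mul, coeff_X_pow]
    simp

theorem coeffH_tendsto_zero (v : H) : Filter.Tendsto (coeffH v) Filter.cofinite (𝓝 0) := by
  have h := (lp.memℓp (fourierBasis.repr v)).summable (by norm_num)
  have h2 := h.tendsto_cofinite_zero
  rw [tendsto_zero_iff_norm_tendsto_zero]
  have h3 := h2.sqrt
  simp only [Real.sqrt_zero] at h3
  refine h3.congr fun n => ?_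
  simp [coeffH]

/-- If the coefficients do not decrease in absolute value along a sequence of
exponents, the first of them vanishes. -/
theorem coeffH_eq_zero_of_monotone (v : H) (e : ℕ → ℤ) (he : Function.Injective e)
    (h : ∀ k, ‖coeffH v (e k)‖ ≤ ‖coeffH v (e (k + 1))‖) : coeffH v (e 0) = 0 := by
  have h1 : Filter.Tendsto (fun k => ‖coeffH v (e k)‖) Filter.atTop (𝓝 0) := by
    have := ((coeffH_tendsto_zero v).comp he.tendsto_cofinite).norm
    rwa [Nat.cofinite_eq_atTop, norm_zero] at this
  have h2 := (monotone_nat_of_le_succ h).ge_of_tendsto h1 0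
  exact norm_le_zero_iff.1 h2

/-! ### The closed subspace `H₊` -/

theorem isClosed_Hplus : IsClosed (Hplus : Set H) := by
  have : (Hplus : Set H) = ⋂ n : ℤ, ⋂ _ : n < 0, {v | coeffH v n = 0} := by
    ext v; simp [Hplus]
  rw [this]
  refine isClosed_iInter fun n => isClosed_iInter fun _ => ?_
  simp_rw [coeffH_eq_inner]
  exact isClosed_eq (by fun_prop) continuous_const

theorem inner_eq_zero_of_coeffH (v w : H) (h : ∀ n, coeffH v n = 0 ∨ coeffH w n = 0) :
    inner ℂ v w = 0 := by
  have h1 := fourierBasis.hasSum_inner_mul_inner v w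
  refine (h1.unique (hasSum_zero.congr_fun ?_) : _)
  intro n
  have h2 : ∀ x : H, inner ℂ (fourierBasis n) x = coeffH x n := fun x => by
    rw [coeffH, HilbertBasis.repr_apply_apply]
  rw [← inner_conj_symm, h2, h2]
  rcases h n with h | h <;> simp [h]

theorem mem_of_forall_orthogonal (V : Gr) (v : H)
    (h : ∀ x : H, (∀ y ∈ V, inner ℂ y x = 0) → inner ℂ x v = 0) : v ∈ V := by
  have h1 : v ∈ (V.toSubmodule)ᗮᗮ := by
    rw [Submodule.mem_orthogonal]
    intro x hx
    exact h x fun y hy => (Submodule.mem_orthogonal _ _).1 hx y hy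
  rwa [Submodule.orthogonal_orthogonal] at h1

theorem Hplus_le_of_orthogonal (V : Gr)
    (h : ∀ x : H, (∀ y ∈ V, inner ℂ y x = 0) → ∀ n : ℕ, coeffH x n = 0) (v : H)
    (hv : v ∈ Hplus) : v ∈ V := by
  refine mem_of_forall_orthogonal V v fun x hx => inner_eq_zero_of_coeffH _ _ fun n => ?_
  rcases lt_or_ge n 0 with hn | hn
  · exact Or.inr (hv n hn)
  · obtain ⟨k, rfl⟩ := Int.eq_ofNat_of_zero_le hn
    exact Or.inl (h x hx k)

theorem Hplus_le_of_fourier_mem (V : Gr) (h : ∀ n : ℕ, ofC (fourier (n : ℤ)) ∈ V) (v : H)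
    (hv : v ∈ Hplus) : v ∈ V :=
  Hplus_le_of_orthogonal V (fun x hx n => by rw [coeffH_eq_inner]; exact hx _ (h n)) v hv

theorem fourier_mem_Hplus (n : ℕ) : ofC (fourier (n : ℤ)) ∈ Hplus := by
  intro k hk
  rw [coeffH_fourier, if_neg (by omega)]

instance : CompleteSpace Hplus := isClosed_Hplus.completeSpace_coe

theorem exists_Hplus_part (v : H) : ∃ w ∈ Hplus, ∀ n : ℕ, coeffH w n = coeffH v n := by
  refine ⟨Hplus.starProjection v, Hplus.starProjection_apply_mem v, fun n => ?_⟩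
  have h := Submodule.starProjection_inner_eq_zero (K := Hplus) v _ (fourier_mem_Hplus n)
  rw [← inner_conj_symm, ← coeffH_eq_inner] at h
  have := (map_eq_zero _).1 h
  rw [coeffH_sub, sub_eq_zero] at this
  exact this.symm

/-! ### The algebra of functions preserving `H₊` -/

/-- The continuous functions `f` with `f H₊ ⊆ H₊`. -/
noncomputable def discAlgebra : Subalgebra ℂ C(S1, ℂ) where
  carrier := {f | ∀ v ∈ Hplus, mulOp f v ∈ Hplus}
  mul_mem' := by
    intro f g hf hg v hv
    rw [mulOp_mul]; exact hf _ (hg _ hv)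
  add_mem' := by
    intro f g hf hg v hv
    rw [mulOp_add_apply]; exact add_mem (hf _ hv) (hg _ hv)
  algebraMap_mem' := by
    intro c v hv
    rw [Algebra.algebraMap_eq_smul_one, mulOp_smul_apply, mulOp_one_apply]
    exact Submodule.smul_mem _ c hv

theorem fourier_one_mem_discAlgebra : (fourier 1 : C(S1, ℂ)) ∈ discAlgebra := by
  intro v hv n hn
  rw [coeffH_mulOp_fourier]
  exact hv _ (by omega)

theorem polyS1_mem_discAlgebra (u : ℂ[X]) : polyS1 u ∈ discAlgebra := by
  have h : polyS1 u ∈ Algebra.adjoin ℂ {(fourier 1 : C(S1, ℂ))} := by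
    rw [Algebra.adjoin_singleton_eq_range_aeval]; exact ⟨u, rfl⟩
  exact Algebra.adjoin_le (by simpa using fourier_one_mem_discAlgebra) h

theorem one_mem_Hplus : ofC 1 ∈ Hplus := by
  have h := fourier_mem_Hplus 0
  have h1 : (fourier ((0 : ℕ) : ℤ) : C(S1, ℂ)) = 1 := by ext; simp
  rwa [h1] at h

/-- For the converse, `f z ^ n = z ^ n f` stays in `H₊`, and the preimage of `H₊` under
multiplication by `f` is a closed subspace, so it contains `H₊` once it contains all `z ^ n` with `n
≥ 0`. -/
theorem mem_discAlgebra_iff {f : C(S1, ℂ)} : f ∈ discAlgebra ↔ ofC f ∈ Hplus := by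
  constructor
  · intro h
    rw [ofC_eq_mulOp]; exact h _ one_mem_Hplus
  · intro h
    let V : Gr := ClosedSubmodule.comap (mulOp f) ⟨Hplus, isClosed_Hplus⟩
    refine fun v hv => Hplus_le_of_fourier_mem V (fun n => ?_) v hv
    change mulOp f (ofC (fourier (n : ℤ))) ∈ Hplus
    rw [mulOp_ofC, mul_comm, ← mulOp_ofC, ← polyS1_monomial]
    exact polyS1_mem_discAlgebra _ _ h

theorem mulOp_left_cancel {u : C(S1, ℂ)} (hu : ∀ θ, u θ ≠ 0) {v w : H}
    (h : mulOp u v = mulOp u w) : v = w := by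
  apply Lp.ext
  filter_upwards [mulOp_ae u v, mulOp_ae u w] with θ h1 h2
  rw [h, h2] at h1
  exact (mul_left_cancel₀ (hu θ) h1).symm

/-- The inverse of a non-vanishing function on the circle. -/
noncomputable def invC (u : C(S1, ℂ)) (hu : ∀ θ, u θ ≠ 0) : C(S1, ℂ) :=
  ⟨fun θ => (u θ)⁻¹, u.continuous.inv₀ hu⟩

theorem mul_invC (u : C(S1, ℂ)) (hu : ∀ θ, u θ ≠ 0) : u * invC u hu = 1 := by
  ext θ; simp [invC, hu θ]

/-! ### Polynomials with all roots in the open disc -/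

/-- Monic polynomials with all roots in the open unit disc. -/
def InDisc (m : ℂ[X]) : Prop := m.Monic ∧ ∀ c, m.eval c = 0 → ‖c‖ < 1

theorem InDisc.one : InDisc 1 := ⟨monic_one, fun c h => by simp at h⟩

theorem InDisc.mul {p q : ℂ[X]} (hp : InDisc p) (hq : InDisc q) : InDisc (p * q) :=
  ⟨hp.1.mul hq.1, fun c h => by
    rw [eval_mul] at h
    exact (mul_eq_zero.1 h).elim (hp.2 c) (hq.2 c)⟩

theorem InDisc.X_sub_C {c : ℂ} (hc : ‖c‖ < 1) : InDisc (X - C c) :=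
  ⟨monic_X_sub_C c, fun d h => by
    rw [eval_sub, eval_X, eval_C, sub_eq_zero] at h; rwa [h]⟩

theorem InDisc.induction {P : ℂ[X] → Prop} (h1 : P 1)
    (hmul : ∀ c m, ‖c‖ < 1 → InDisc m → P m → P ((X - C c) * m)) {m : ℂ[X]} (hm : InDisc m) :
    P m := by
  have key : ∀ s : Multiset ℂ, (∀ c ∈ s, ‖c‖ < 1) →
      InDisc (s.map fun a => X - C a).prod ∧ P (s.map fun a => X - C a).prod := by
    intro s
    induction s using Multiset.induction_on with
    | empty => intro _; simpa using ⟨InDisc.one, h1⟩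
    | cons a s ih =>
      intro h
      rw [Multiset.map_cons, Multiset.prod_cons]
      have ha := h a (Multiset.mem_cons_self a s)
      obtain ⟨i1, i2⟩ := ih fun c hc => h c (Multiset.mem_cons_of_mem hc)
      exact ⟨(InDisc.X_sub_C ha).mul i1, hmul a _ ha i1 i2⟩
  have h2 := (IsAlgClosed.splits m).eq_prod_roots_of_monic hm.1
  rw [h2]
  exact (key _ fun c hc => hm.2 c (isRoot_of_mem_roots hc)).2

theorem norm_fourier_one (θ : S1) : ‖(fourier 1 θ : ℂ)‖ = 1 := by
  rw [fourier_apply]; exact Circle.norm_coe _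

theorem InDisc.polyS1_ne_zero {m : ℂ[X]} (hm : InDisc m) (θ : S1) : polyS1 m θ ≠ 0 := by
  rw [polyS1_apply]
  intro h
  exact absurd (hm.2 _ h) (by rw [norm_fourier_one]; exact lt_irrefl _)

/-- Strips from a non-zero polynomial its leading coefficient and every root outside the open disc.
The linear factors are treated one by one, and those with a root in the disc accumulate in `p`. -/
theorem exists_inDisc_of_forall {P : ℂ[X] → Prop}
    (hC : ∀ a p, a ≠ 0 → P (C a * p) → P p)
    (hX : ∀ c p, 1 ≤ ‖c‖ → P ((X - C c) * p) → P p) {p : ℂ[X]} (hp : p ≠ 0) (h : P p) :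
    ∃ p', InDisc p' ∧ P p' := by
  have key : ∀ s : Multiset ℂ, ∀ p, InDisc p → P ((s.map fun a => X - C a).prod * p) →
      ∃ p', InDisc p' ∧ P p' := by
    intro s
    induction s using Multiset.induction_on with
    | empty => intro p hp h; exact ⟨p, hp, by simpa using h⟩
    | cons a s ih =>
      intro p hp h
      rw [Multiset.map_cons, Multiset.prod_cons] at h
      rcases lt_or_ge ‖a‖ 1 with ha | ha
      · refine ih ((X - C a) * p) ((InDisc.X_sub_C ha).mul hp) ?_
        rwa [mul_comm (X - C a), mul_assoc] at h
      · rw [mul_assoc] at h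
        exact ih p hp (hX a _ ha h)
  refine key p.roots 1 InDisc.one (hC p.leadingCoeff _ (leadingCoeff_ne_zero.2 hp) ?_)
  rw [mul_one, ← (IsAlgClosed.splits p).eq_prod_roots]
  exact h

/-- Division by `z - c`: let `k` be the `H₊` part of `h / (z - c)`. Truncating the quotient changes
the coefficients of the product in degrees `n ≥ 0` only at `n = 0`, by the coefficient of `z⁻¹` in
the quotient; this is the remainder. -/
theorem exists_eq_smul_add (c : ℂ) (hc : ‖c‖ < 1) (h : H) (hh : h ∈ Hplus) :
    ∃ (a : ℂ) (k : H), k ∈ Hplus ∧ h = a • ofC 1 + mulOp (polyS1 (X - C c)) k := by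
  obtain ⟨k, hk, hkc⟩ := exists_Hplus_part
    (mulOp (invC _ (InDisc.X_sub_C hc).polyS1_ne_zero) h)
  set k₀ := mulOp (invC _ (InDisc.X_sub_C hc).polyS1_ne_zero) h
  have h0 : h = mulOp (polyS1 (X - C c)) k₀ := by
    rw [← mulOp_mul, mul_invC, mulOp_one_apply]
  have e1 : (1 : C(S1, ℂ)) = fourier (0 : ℤ) := by ext; simp
  refine ⟨coeffH k₀ (-1), k, hk, coeffH_ext fun n => ?_⟩
  rw [coeffH_add, coeffH_smul, e1, coeffH_fourier, coeffH_X_sub_C]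
  rcases lt_trichotomy n 0 with hn | rfl | hn
  · rw [hh n hn, hk n hn, hk (n - 1) (by omega), if_neg hn.ne]; simp
  · rw [h0, coeffH_X_sub_C, hk (0 - 1) (by omega)]
    have := hkc 0
    rw [Nat.cast_zero] at this
    rw [this, if_pos rfl]; simp [sub_eq_add_neg]
  · obtain ⟨j, rfl⟩ : ∃ j : ℕ, n = (j + 1 : ℕ) := ⟨(n - 1).toNat, by omega⟩
    have e2 : ((j + 1 : ℕ) : ℤ) - 1 = (j : ℕ) := by push_cast; ring
    rw [h0, coeffH_X_sub_C, if_neg hn.ne', hkc, e2, hkc]; simp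

/-- Division with remainder in `H₊`. -/
theorem InDisc.exists_eq_poly_add {m : ℂ[X]} (hm : InDisc m) (h : H) (hh : h ∈ Hplus) :
    ∃ (r : ℂ[X]) (k : H), r.degree < m.degree ∧ k ∈ Hplus ∧
      h = ofC (polyS1 r) + mulOp (polyS1 m) k := by
  have key : ∀ h ∈ Hplus, ∃ (r : ℂ[X]) (k : H), k ∈ Hplus ∧
      h = ofC (polyS1 r) + mulOp (polyS1 m) k := by
    refine hm.induction (P := fun m => ∀ h ∈ Hplus, ∃ (r : ℂ[X]) (k : H), k ∈ Hplus ∧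
      h = ofC (polyS1 r) + mulOp (polyS1 m) k) ?_ ?_
    · intro h hh
      exact ⟨0, h, hh, by simp [mulOp_one_apply]⟩
    · intro c m hc _ ih h hh
      obtain ⟨r, k, hk, rfl⟩ := ih h hh
      obtain ⟨a, k', hk', rfl⟩ := exists_eq_smul_add c hc k hk
      refine ⟨r + C a * m, k', hk', ?_⟩
      rw [map_add polyS1, map_mul polyS1 (C a), polyS1_C, smul_mul_assoc, one_mul, map_add ofC,
        map_smul ofC, map_add (mulOp _), map_smul (mulOp _), mulOp_ofC, mul_one, add_assoc,
        ← mulOp_mul, ← map_mul, mul_comm m]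
  obtain ⟨r, k, hk, rfl⟩ := key h hh
  refine ⟨r %ₘ m, k + ofC (polyS1 (r /ₘ m)), degree_modByMonic_lt _ hm.1,
    add_mem hk (mem_discAlgebra_iff.1 (polyS1_mem_discAlgebra _)), ?_⟩
  conv_lhs => rw [← modByMonic_add_div r m]
  rw [map_add, map_add, map_mul, map_add, mulOp_ofC]
  abel

/-- Uniqueness of division with remainder. If `a` is the remainder of `f` by `X - c`, the quotient
difference `x` satisfies `(z - c) x = a`. Its coefficients then obey `x_{n-1} = c x_n` for `n ≥ 1`;
as `|c| < 1`, they do not decrease in modulus, so `x_0 = 0`. Since `x_{-1} = 0` as well, degree 0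
gives `a = 0`. -/
theorem InDisc.dvd_of_mulOp_eq {m : ℂ[X]} (hm : InDisc m) {k : H} (hk : k ∈ Hplus) {f : ℂ[X]}
    (h : mulOp (polyS1 m) k = ofC (polyS1 f)) : m ∣ f := by
  refine hm.induction (P := fun m => ∀ f : ℂ[X], mulOp (polyS1 m) k = ofC (polyS1 f) → m ∣ f)
    (fun f _ => one_dvd f) ?_ f h
  intro c m hc hm ih f hf
  obtain ⟨f₁, a, rfl⟩ : ∃ f₁ a, f = (X - C c) * f₁ + C a :=
    ⟨f /ₘ (X - C c), f.eval c, by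
      conv_lhs => rw [← modByMonic_add_div f (X - C c), modByMonic_X_sub_C_eq_C_eval]
      ring⟩
  set x := mulOp (polyS1 m) k - ofC (polyS1 f₁) with hx
  have hxH : x ∈ Hplus := sub_mem (polyS1_mem_discAlgebra m k hk)
    (mem_discAlgebra_iff.1 (polyS1_mem_discAlgebra _))
  have h1 : mulOp (polyS1 (X - C c)) x = a • ofC 1 := by
    rw [hx, map_sub, ← mulOp_mul, ← map_mul, hf, mulOp_ofC, ← map_sub, ← map_mul, ← map_sub,
      add_sub_cancel_left, polyS1_C, map_smul]
  have e1 : (1 : C(S1, ℂ)) = fourier (0 : ℤ) := by ext; simp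
  have h2 : ∀ n : ℤ, coeffH x (n - 1) - c * coeffH x n = a * if n = 0 then 1 else 0 := by
    intro n
    rw [← coeffH_X_sub_C, h1, coeffH_smul, e1, coeffH_fourier]
  have h3 : coeffH x 0 = 0 := by
    refine coeffH_eq_zero_of_monotone x (fun k : ℕ => (k : ℤ)) Nat.cast_injective fun k => ?_
    have := h2 (k + 1)
    rw [if_neg (by omega), mul_zero, sub_eq_zero, add_sub_cancel_right] at this
    rw [this, norm_mul]
    push_cast
    exact mul_le_of_le_one_left (norm_nonneg _) hc.le
  have h4 : a = 0 := by
    have := h2 0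
    rw [h3, hxH (0 - 1) (by omega)] at this
    simpa using this.symm
  subst h4
  rw [C_0, add_zero] at hf ⊢
  refine mul_dvd_mul_left _ (ih f₁ (mulOp_left_cancel (InDisc.X_sub_C hc).polyS1_ne_zero ?_))
  rw [← mulOp_mul, ← map_mul, hf, mulOp_ofC, ← map_mul]

/-! ### Points of `Gr₁` -/

/-- `p H₊ ⊆ W ⊆ q⁻¹ H₊` with monic `p`, `q` having all their roots in the open disc. -/
structure Between (p q : ℂ[X]) (W : Gr) : Prop where
  inDisc_left : InDisc p
  inDisc_right : InDisc q
  lower : ∀ v ∈ Hplus, mulOp (polyS1 p) v ∈ W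
  upper : ∀ w ∈ W, mulOp (polyS1 q) w ∈ Hplus

theorem fourier_one_mul (n : ℤ) :
    (fourier 1 * fourier n : C(S1, ℂ)) = fourier (n + 1) := by
  ext θ
  rw [ContinuousMap.mul_apply, ← fourier_add, add_comm]

/-- For `|c| ≥ 1` the space `(z - c) H₊` is dense in `H₊`: a vector orthogonal to all `(z - c) z ^
n`, `n ≥ 0`, has non-negative coefficients of non-decreasing modulus, hence zero. Closedness of `W`
does the rest. -/
theorem lower_of_mul_X_sub_C (W : Gr) {c : ℂ} (hc : 1 ≤ ‖c‖) (p : ℂ[X])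
    (h : ∀ v ∈ Hplus, mulOp (polyS1 ((X - C c) * p)) v ∈ W) (v : H) (hv : v ∈ Hplus) :
    mulOp (polyS1 p) v ∈ W := by
  rw [← ClosedSubmodule.mem_comap]
  refine Hplus_le_of_orthogonal _ (fun x hx n => ?_) v hv
  have key : coeffH x ((fun k : ℕ => (n : ℤ) + k) 0) = 0 := by
    refine coeffH_eq_zero_of_monotone x (fun k : ℕ => (n : ℤ) + k) (fun a b hab => by simpa using hab)
      fun k => ?_
    have h1 := hx (mulOp (polyS1 (X - C c)) (ofC (fourier ((n + k : ℕ) : ℤ)))) (by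
      rw [ClosedSubmodule.mem_comap, ← mulOp_mul, ← map_mul, mul_comm p]
      exact h _ (fourier_mem_Hplus _))
    rw [map_sub, mulOp_sub_apply, mulOp_C, polyS1_X, mulOp_ofC, fourier_one_mul, inner_sub_left,
      inner_smul_left, ← coeffH_eq_inner, ← coeffH_eq_inner, sub_eq_zero] at h1
    have e1 : (n : ℤ) + ((k + 1 : ℕ) : ℤ) = ((n + k : ℕ) : ℤ) + 1 := by push_cast; ring
    have e2 : (n : ℤ) + (k : ℤ) = ((n + k : ℕ) : ℤ) := by push_cast; ring
    rw [e1, e2, h1, norm_mul, RCLike.norm_conj]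
    exact le_mul_of_one_le_left (norm_nonneg _) hc
  simpa using key

/-- In negative degrees `v_{n-1} = c v_n` with `|c| ≥ 1`, so a non-zero coefficient would prevent
decay towards `-∞`. -/
theorem upper_of_mul_X_sub_C {c : ℂ} (hc : 1 ≤ ‖c‖) (v : H)
    (h : mulOp (polyS1 (X - C c)) v ∈ Hplus) : v ∈ Hplus := by
  intro n hn
  have := coeffH_eq_zero_of_monotone v (fun k : ℕ => n - k) (fun a b hab => by simpa using hab)
    fun k => ?_
  · simpa using this
  have h1 := h (n - k) (by omega)
  rw [coeffH_X_sub_C, sub_eq_zero] at h1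
  have e : n - ((k + 1 : ℕ) : ℤ) = n - k - 1 := by push_cast; ring
  rw [e, h1, norm_mul]
  exact le_mul_of_one_le_left (norm_nonneg _) hc

theorem InGr1.exists_between {W : Gr} (hW : InGr1 W) :
    ∃ p q, Between p q W ∧ 0 < (p * q).natDegree := by
  obtain ⟨p, q, hp, hq, h1, h2⟩ := hW
  obtain ⟨p', hp', h1'⟩ := exists_inDisc_of_forall
    (P := fun p => ∀ v ∈ Hplus, mulOp (polyS1 p) v ∈ W) (fun a p ha h v hv => by
      have := h (a⁻¹ • v) (Submodule.smul_mem _ _ hv)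
      rwa [map_mul, mulOp_mul, mulOp_C, map_smul, smul_smul, mul_inv_cancel₀ ha,
        one_smul] at this)
    (fun c p hc h => lower_of_mul_X_sub_C W hc p h) hp h1
  obtain ⟨q', hq', h2'⟩ := exists_inDisc_of_forall
    (P := fun q => ∀ w ∈ W, mulOp (polyS1 q) w ∈ Hplus) (fun a q ha h v hv => by
      have := Submodule.smul_mem _ a⁻¹ (h v hv)
      rwa [map_mul, mulOp_mul, mulOp_C, smul_smul, inv_mul_cancel₀ ha, one_smul] at this)
    (fun c q hc h v hv => upper_of_mul_X_sub_C hc _ (by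
      have := h v hv
      rwa [map_mul, mulOp_mul] at this)) hq h2
  -- An extra factor `z` in `p` is harmless and makes `deg (p * q)` positive, so that the constant 1
  -- is among the polynomials of degree less than `deg (p * q)` used in `Between.exists_multiplier`.
  have hX := InDisc.X_sub_C (c := 0) (by simp)
  refine ⟨(X - C 0) * p', q', ⟨hX.mul hp', hq', fun v hv => ?_, h2'⟩, ?_⟩
  · rw [mul_comm, map_mul, mulOp_mul]
    exact h1' _ (polyS1_mem_discAlgebra _ v hv)
  · rw [mul_assoc, hX.1.natDegree_mul (hp'.1.mul hq'.1), natDegree_X_sub_C]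
    omega

/-! ### Boundary values of holomorphic functions -/

theorem fourier_one_coe (x : ℝ) : (fourier 1 (x : S1) : ℂ) = circleMap 0 1 (2 * Real.pi * x) := by
  rw [fourier_coe_apply, circleMap]
  push_cast
  simp only [div_one, zero_add, one_mul, mul_one]
  congr 1
  ring

theorem integral_circleMap_mul (G : ℂ → ℂ) :
    ∫ x in (0 : ℝ)..1, circleMap 0 1 (2 * Real.pi * x) * G (circleMap 0 1 (2 * Real.pi * x)) =
      (2 * Real.pi * Complex.I)⁻¹ * ∮ z in C(0, 1), G z := by
  have h := intervalIntegral.integral_comp_mul_left (a := 0) (b := 1)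
    (fun x : ℝ => circleMap 0 1 x * G (circleMap 0 1 x))
    (c := 2 * Real.pi) (by positivity)
  rw [h, circleIntegral]
  simp only [deriv_circleMap, mul_zero, mul_one, smul_eq_mul]
  have e : ∀ x : ℝ, circleMap 0 1 x * Complex.I * G (circleMap 0 1 x) =
    Complex.I * (circleMap 0 1 x * G (circleMap 0 1 x)) := fun x => by ring
  simp_rw [e]
  rw [intervalIntegral.integral_const_mul, Complex.real_smul]
  have := Complex.I_ne_zero
  have := Real.pi_ne_zero
  push_cast
  field_simp

/-- The coefficient of `z ^ (-n)` is the mean of `z ^ n f` over the circle, which by Cauchy's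
formula is the value of `z ^ n f` at 0. -/
theorem fourierCoeff_of_analytic {f : ℂ → ℂ} (hf : AnalyticOnNhd ℂ f (Metric.closedBall 0 1))
    (n : ℕ) :
    fourierCoeff (fun θ : S1 => f (fourier 1 θ)) (-(n : ℤ)) = if n = 0 then f 0 else 0 := by
  rw [fourierCoeff_eq_intervalIntegral _ _ 0]
  simp only [neg_neg, zero_add, div_one, one_smul]
  have hz : ∀ x : ℝ, circleMap 0 1 x ≠ 0 := fun x => circleMap_ne_center one_ne_zero
  have e : ∀ x : ℝ, (fourier (n : ℤ) (x : S1) : ℂ) • f (fourier 1 (x : S1)) =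
      circleMap 0 1 (2 * Real.pi * x) * (fun z => (z - 0)⁻¹ • (z ^ n * f z))
        (circleMap 0 1 (2 * Real.pi * x)) := by
    intro x
    have := hz (2 * Real.pi * x)
    rw [← fourier_one_pow, ContinuousMap.pow_apply, fourier_one_coe]
    simp only [smul_eq_mul, sub_zero]
    field_simp
  simp_rw [e]
  refine (integral_circleMap_mul (fun z => (z - 0)⁻¹ • (z ^ n * f z))).trans ?_
  have hd : DifferentiableOn ℂ (fun z => z ^ n * f z) (Metric.closedBall 0 1) :=
    (differentiableOn_id.pow n).mul hf.differentiableOn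
  rw [DiffContOnCl.circleIntegral_sub_inv_smul
    (hd.diffContOnCl_ball subset_rfl) (by simp)]
  have := Complex.I_ne_zero
  have := Real.pi_ne_zero
  rw [smul_eq_mul]
  rcases Nat.eq_zero_or_pos n with rfl | hn
  · simp only [pow_zero, one_mul, if_true]; field_simp
  · simp [hn.ne']

theorem mem_discAlgebra_of_analytic {f : ℂ → ℂ} {g : C(S1, ℂ)}
    (hf : AnalyticOnNhd ℂ f (Metric.closedBall 0 1)) (hg : ∀ θ, g θ = f (fourier 1 θ)) :
    g ∈ discAlgebra := by
  rw [mem_discAlgebra_iff]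
  intro n hn
  obtain ⟨k, rfl⟩ : ∃ k : ℕ, n = -(k : ℤ) := ⟨(-n).toNat, by omega⟩
  rw [coeffH_ofC, funext hg, fourierCoeff_of_analytic hf, if_neg (by omega)]

theorem GammaPlus.mem_discAlgebra {g : C(S1, ℂ)ˣ} (hg : g ∈ GammaPlus) :
    (g : C(S1, ℂ)) ∈ discAlgebra := by
  obtain ⟨f, hf, hgf⟩ := hg
  exact mem_discAlgebra_of_analytic hf.1 hgf

theorem fourierCoeff_comp_neg (k : S1 → ℂ) (n : ℤ) :
    fourierCoeff (fun θ => k (-θ)) n = fourierCoeff k (-n) := by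
  rw [fourierCoeff, fourierCoeff, ← integral_neg_eq_self]
  congr 1
  ext θ
  rw [neg_neg, neg_neg]
  congr 1
  simp [fourier_apply]

theorem GammaMinus.coeffH {g : C(S1, ℂ)ˣ} (hg : g ∈ GammaMinus) (n : ℕ) :
    coeffH (ofC (g : C(S1, ℂ))) n = if n = 0 then 1 else 0 := by
  obtain ⟨f, hf, hgf⟩ := hg
  have e : ⇑(g : C(S1, ℂ)) = fun θ => (fun θ => f (fourier 1 θ)) (-θ) := by
    ext θ
    rw [hgf]
    congr 1
    rw [fourier_apply, fourier_apply, one_smul, one_smul, AddCircle.toCircle_neg,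
      Circle.coe_inv]
  rw [coeffH_ofC, e, fourierCoeff_comp_neg (fun θ => f (fourier 1 θ)), fourierCoeff_of_analytic hf.1, hf.2.2]

/-- Division with remainder in the disc algebra. -/
theorem InDisc.exists_eq_poly_add_mul {m : ℂ[X]} (hm : InDisc m) {f : C(S1, ℂ)}
    (hf : f ∈ discAlgebra) : ∃ r : ℂ[X], ∃ h ∈ discAlgebra, f = polyS1 r + polyS1 m * h := by
  obtain ⟨r, k, -, hk, hrk⟩ := hm.exists_eq_poly_add _ (mem_discAlgebra_iff.1 hf)
  have h1 : f = polyS1 r + polyS1 m * (invC _ hm.polyS1_ne_zero * (f - polyS1 r)) := by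
    rw [← mul_assoc, mul_invC, one_mul, add_sub_cancel]
  refine ⟨r, _, ?_, h1⟩
  rw [mem_discAlgebra_iff]
  convert hk
  refine mulOp_left_cancel hm.polyS1_ne_zero ?_
  rw [mulOp_ofC, ← mul_assoc, mul_invC, one_mul, map_sub, hrk, add_sub_cancel_left]

theorem InDisc.dvd_of_eq_mul {m : ℂ[X]} (hm : InDisc m) {h : C(S1, ℂ)} (hh : h ∈ discAlgebra)
    {f : ℂ[X]} (hf : polyS1 f = polyS1 m * h) : m ∣ f := by
  refine hm.dvd_of_mulOp_eq (mem_discAlgebra_iff.1 hh) ?_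
  rw [mulOp_ofC, hf]

/-! ### Exponentials with prescribed residues -/

/-- Hermite interpolation by an exponential, adding one root `c` of `m` at a time. Replacing `l` by
`l + s m` keeps the congruence modulo `m` and changes the quotient into the entire function `k s`.
It suffices to choose `s` with `k s c = 0` and divide by `z - c`. -/
theorem exists_exp_eq_add_mul {m : ℂ[X]} (hm : InDisc m) (u : ℂ[X])
    (hu : ∀ c, m.eval c = 0 → u.eval c ≠ 0) :
    ∃ (l : ℂ[X]) (h : ℂ → ℂ), Differentiable ℂ h ∧
      ∀ z, Complex.exp (l.eval z) = u.eval z + m.eval z * h z := by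
  revert hu
  refine hm.induction (P := fun m => (∀ c, m.eval c = 0 → u.eval c ≠ 0) →
    ∃ (l : ℂ[X]) (h : ℂ → ℂ), Differentiable ℂ h ∧
      ∀ z, Complex.exp (l.eval z) = u.eval z + m.eval z * h z) ?_ ?_
  · intro _
    exact ⟨0, fun z => 1 - u.eval z, (differentiable_const _).sub u.differentiable,
      fun z => by simp⟩
  intro c m _ _ ih hu
  obtain ⟨l, h, hh, hl⟩ := ih fun d hd => hu d (by rw [eval_mul, hd, mul_zero])
  have dE : ∀ (f : ℂ → ℂ) (a : ℂ), Differentiable ℂ f → Differentiable ℂ (dslope f a) :=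
    fun f a hf => by
      rw [← differentiableOn_univ] at hf ⊢
      exact (Complex.differentiableOn_dslope Filter.univ_mem).2 hf
  set E : ℂ → ℂ := dslope Complex.exp 0
  have hE : ∀ w, Complex.exp w = 1 + w * E w := fun w => by
    have := sub_smul_dslope Complex.exp 0 w
    rw [smul_eq_mul, sub_zero, Complex.exp_zero] at this
    rw [this]; ring
  have hE0 : E 0 = 1 := by simp [E, dslope_same]
  set k : ℂ → ℂ → ℂ := fun s z => h z + Complex.exp (l.eval z) * (s * E (s * m.eval z))
  have hk : ∀ s z, Complex.exp ((l + C s * m).eval z) = u.eval z + m.eval z * k s z := by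
    intro s z
    rw [eval_add, eval_mul, eval_C, Complex.exp_add, hE (s * m.eval z)]
    simp only [k]
    linear_combination hl z
  have hkd : ∀ s, Differentiable ℂ (k s) := fun s =>
    hh.add ((Complex.differentiable_exp.comp l.differentiable).mul
      ((differentiable_const s).mul ((dE _ 0 Complex.differentiable_exp).comp
        ((differentiable_const s).mul m.differentiable))))
  obtain ⟨s, hs⟩ : ∃ s, k s c = 0 := by
    -- At a repeated root `k s c` is affine in `s` with non-zero slope `exp (l c)`; at a new root
    -- `s` is chosen so that the exponent takes the value `log (u c)`.
    by_cases hc : m.eval c = 0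
    · refine ⟨-h c * (Complex.exp (l.eval c))⁻¹, ?_⟩
      have := Complex.exp_ne_zero (l.eval c)
      simp only [k]
      rw [hc, mul_zero, hE0]
      field_simp
      ring
    · refine ⟨(Complex.log (u.eval c) - l.eval c) / m.eval c, ?_⟩
      have h1 := hk ((Complex.log (u.eval c) - l.eval c) / m.eval c) c
      rw [eval_add, eval_mul, eval_C, div_mul_cancel₀ _ hc, add_sub_cancel,
        Complex.exp_log (hu c (by simp))] at h1
      have h2 := left_eq_add.1 h1
      exact (mul_eq_zero.1 h2).resolve_left hc
  refine ⟨l + C s * m, dslope (k s) c, dE _ _ (hkd s), fun z => ?_⟩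
  have := sub_smul_dslope (k s) c z
  rw [smul_eq_mul, hs, sub_zero] at this
  rw [hk, ← this, eval_mul, eval_sub, eval_X, eval_C]
  ring

/-- Every unit modulo `m` is, up to a constant, the residue of an element of `Γ₊`. -/
theorem exists_GammaPlus_eq {m : ℂ[X]} (hm : InDisc m) (u : ℂ[X])
    (hu : ∀ c, m.eval c = 0 → u.eval c ≠ 0) :
    ∃ g ∈ GammaPlus, ∃ a : ℂ, a ≠ 0 ∧ ∃ h ∈ discAlgebra,
      (g : C(S1, ℂ)) = polyS1 (C a * u) + polyS1 m * h := by
  obtain ⟨l, h, hh, hl⟩ := exists_exp_eq_add_mul hm u hu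
  set a := Complex.exp (-l.eval 0)
  set f : ℂ → ℂ := fun z => Complex.exp (l.eval z - l.eval 0)
  have hfd : Differentiable ℂ f :=
    Complex.differentiable_exp.comp (l.differentiable.sub (differentiable_const _))
  have hf : IsDiscUnit f := ⟨fun z _ => hfd.analyticAt z, fun z _ => Complex.exp_ne_zero _,
    by simp [f]⟩
  have hfe : ∀ z, f z = a * u.eval z + m.eval z * (a * h z) := fun z => by
    simp only [f, a]
    rw [sub_eq_add_neg, Complex.exp_add, hl]; ring
  let g₀ : C(S1, ℂ) := ⟨fun θ => f (fourier 1 θ),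
    hfd.continuous.comp (fourier 1 : C(S1, ℂ)).continuous⟩
  let h₀ : C(S1, ℂ) := ⟨fun θ => a * h (fourier 1 θ),
    continuous_const.mul (hh.continuous.comp (fourier 1 : C(S1, ℂ)).continuous)⟩
  have hg₀ : ∀ θ, g₀ θ ≠ 0 := fun θ => Complex.exp_ne_zero _
  refine ⟨Units.mkOfMulEqOne g₀ (invC g₀ hg₀) (mul_invC g₀ hg₀), ⟨f, hf, fun θ => rfl⟩, a,
    Complex.exp_ne_zero _, h₀, ?_, ?_⟩
  · exact mem_discAlgebra_of_analytic (f := fun z => a * h z)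
      (fun z _ => ((differentiable_const a).mul hh).analyticAt z) fun θ => rfl
  · ext θ
    change f (fourier 1 θ) = polyS1 (C a * u) θ + polyS1 m θ * (a * h (fourier 1 θ))
    rw [polyS1_apply, polyS1_apply, hfe, eval_mul, eval_C]

/-! ### Elements of finite order -/

/-- The elements of `H` with finitely many positive powers of `z`. -/
noncomputable def finiteOrder : Submodule ℂ H where
  carrier := {w | ∃ N : ℤ, ∀ n > N, coeffH w n = 0}
  zero_mem' := ⟨0, by simp⟩
  add_mem' := by
    rintro v w ⟨M, hM⟩ ⟨N, hN⟩
    refine ⟨max M N, fun n hn => ?_⟩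
    rw [coeffH_add, hM n (lt_of_le_of_lt (le_max_left _ _) hn),
      hN n (lt_of_le_of_lt (le_max_right _ _) hn), add_zero]
  smul_mem' := by
    rintro c v ⟨M, hM⟩
    exact ⟨M, fun n hn => by rw [coeffH_smul, hM n hn, mul_zero]⟩

theorem poly_mul_mem_finiteOrder (u : ℂ[X]) {w : H} (hw : w ∈ finiteOrder) :
    mulOp (polyS1 u) w ∈ finiteOrder := by
  induction u using Polynomial.induction_on' with
  | add p q hp hq => rw [map_add, mulOp_add_apply]; exact add_mem hp hq
  | monomial n a =>
    rw [← C_mul_X_pow_eq_monomial, map_mul, mulOp_mul, mulOp_C, polyS1_monomial]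
    refine Submodule.smul_mem _ _ ?_
    obtain ⟨N, hN⟩ := hw
    exact ⟨N + n, fun k hk => by rw [coeffH_mulOp_fourier]; exact hN _ (by omega)⟩

theorem one_mem_finiteOrder : ofC 1 ∈ finiteOrder := by
  have e1 : (1 : C(S1, ℂ)) = fourier (0 : ℤ) := by ext; simp
  exact ⟨0, fun n hn => by rw [e1, coeffH_fourier, if_neg (by omega)]⟩

theorem poly_mem_finiteOrder (u : ℂ[X]) : ofC (polyS1 u) ∈ finiteOrder := by
  rw [ofC_eq_mulOp]
  exact poly_mul_mem_finiteOrder u one_mem_finiteOrder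

/-- Where the coefficients of `(z - c) w` vanish, `w_{n-1} = c w_n` with `|c| < 1`, so those of `w`
cannot decay towards `+∞` unless they are zero. -/
theorem InDisc.mem_finiteOrder {m : ℂ[X]} (hm : InDisc m) {w : H}
    (hw : mulOp (polyS1 m) w ∈ finiteOrder) : w ∈ finiteOrder := by
  refine hm.induction (P := fun m => mulOp (polyS1 m) w ∈ finiteOrder → w ∈ finiteOrder)
    (fun h => by rwa [map_one, mulOp_one_apply] at h) ?_ hw
  rintro c m hc _ ih ⟨N, hN⟩
  refine ih ⟨N, fun n hn => ?_⟩
  rw [map_mul, mulOp_mul] at hN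
  have key : coeffH (mulOp (polyS1 m) w) ((fun k : ℕ => n + (k : ℤ)) 0) = 0 := by
    refine coeffH_eq_zero_of_monotone _ (fun k : ℕ => n + (k : ℤ))
      (fun a b hab => by simpa using hab) fun k => ?_
    have h1 := hN (n + (k + 1 : ℕ)) (by push_cast; omega)
    rw [coeffH_X_sub_C, sub_eq_zero] at h1
    have e : n + ((k + 1 : ℕ) : ℤ) - 1 = n + (k : ℤ) := by push_cast; ring
    rw [e] at h1
    rw [h1, norm_mul]
    exact mul_le_of_le_one_left (norm_nonneg _) hc.le
  simpa using key

theorem polyS1_injective : Function.Injective polyS1 := by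
  intro u v h
  ext n
  rw [← coeffH_poly, h, coeffH_poly]

theorem eq_polyS1_of_finiteOrder {f : C(S1, ℂ)} (h1 : ofC f ∈ Hplus) (h2 : ofC f ∈ finiteOrder) :
    ∃ u : ℂ[X], f = polyS1 u := by
  obtain ⟨N, hN⟩ := h2
  refine ⟨∑ n ∈ Finset.range (N.toNat + 1), C (coeffH (ofC f) n) * X ^ n,
    ofC_injective (coeffH_ext fun n => ?_)⟩
  rcases lt_or_ge n 0 with hn | hn
  · rw [h1 n hn, mem_discAlgebra_iff.1 (polyS1_mem_discAlgebra _) n hn]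
  · obtain ⟨k, rfl⟩ := Int.eq_ofNat_of_zero_le hn
    rw [coeffH_poly, finsetSum_coeff]
    simp only [coeff_C_mul_X_pow]
    rw [Finset.sum_ite_eq (Finset.range (N.toNat + 1)) k]
    split_ifs with hk
    · rfl
    · rw [Finset.mem_range] at hk
      exact hN _ (by omega)

theorem dvd_of_forall_pow_dvd {m r : ℂ[X]} (h : ∀ n : ℕ, m ^ n ∣ r ^ (n + 1)) : m ∣ r := by
  by_cases hr : r = 0
  · rw [hr]; exact dvd_zero m
  have hm : m ≠ 0 := by
    rintro rfl
    have := h 1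
    rw [pow_one, zero_dvd_iff] at this
    exact hr (pow_eq_zero_iff (by norm_num) |>.1 this)
  rw [(IsAlgClosed.splits m).dvd_iff_roots_le_roots hm hr, Multiset.le_iff_count]
  intro c
  by_contra! hc
  -- With multiplicities `μ` in `m` and `ν < μ` in `r`, the exponent `n = ν + 1` gives `(ν + 1) ^ 2
  -- ≤ (ν + 1) μ ≤ (ν + 2) ν`, which is absurd.
  have h1 := roots.le_of_dvd (pow_ne_zero _ hr) (h (r.roots.count c + 1))
  rw [roots_pow, roots_pow] at h1
  have h2 := Multiset.le_iff_count.1 h1 c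
  rw [Multiset.count_nsmul, Multiset.count_nsmul] at h2
  nlinarith

/-- The polynomial ring is completely integrally closed. If `f m = r` and `f ^ (n + 1) m = s`, then
`r ^ (n + 1) = m ^ n s`; so `m ^ n` divides `r ^ (n + 1)` for all `n`, whence `m` divides `r`. -/
theorem eq_polyS1_of_forall_pow {m : ℂ[X]} (hm : InDisc m) {f : C(S1, ℂ)}
    (h : ∀ n : ℕ, ∃ r, f ^ n * polyS1 m = polyS1 r) : ∃ u, f = polyS1 u := by
  obtain ⟨r, hr⟩ := h 1
  rw [pow_one] at hr
  obtain ⟨u, rfl⟩ : m ∣ r := dvd_of_forall_pow_dvd fun n => by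
    obtain ⟨s, hs⟩ := h (n + 1)
    refine ⟨s, polyS1_injective ?_⟩
    rw [map_pow, ← hr, map_mul, map_pow, ← hs]
    ring
  refine ⟨u, ?_⟩
  ext θ
  have := congrArg (fun k : C(S1, ℂ) => k θ) hr
  simp only [map_mul, ContinuousMap.mul_apply] at this
  rw [mul_comm] at this
  exact mul_left_cancel₀ (hm.polyS1_ne_zero θ) this

/-! ### The action of `Γ₊` and `Γ₋` -/

theorem mulOp_mem_smul (g : C(S1, ℂ)ˣ) {W : Gr} {w : H} (hw : w ∈ W) :
    mulOp (g : C(S1, ℂ)) w ∈ g • W := (mem_smul_iff g W _).2 ⟨w, hw, rfl⟩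

theorem mulOp_units_inv (g : C(S1, ℂ)ˣ) (v : H) :
    mulOp (g : C(S1, ℂ)) (mulOp ((g⁻¹ : C(S1, ℂ)ˣ) : C(S1, ℂ)) v) = v := by
  rw [← mulOp_mul, Units.mul_inv, mulOp_one_apply]

/-- An element of `Γ₊` and its inverse both preserve `H₊` and commute with polynomials. -/
theorem Between.smul {p q : ℂ[X]} {W : Gr} (h : Between p q W) {g : C(S1, ℂ)ˣ}
    (hg : g ∈ GammaPlus) : Between p q (g • W) where
  inDisc_left := h.inDisc_left
  inDisc_right := h.inDisc_right
  lower v hv := by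
    rw [← mulOp_units_inv g v, mulOp_comm]
    exact mulOp_mem_smul g (h.lower _
      (GammaPlus.mem_discAlgebra (inv_mem hg) v hv))
  upper w hw := by
    obtain ⟨w', hw', rfl⟩ := (mem_smul_iff g W _).1 hw
    rw [mulOp_comm]
    exact GammaPlus.mem_discAlgebra hg _ (h.upper _ hw')

theorem Between.inDisc_mul {p q : ℂ[X]} {W : Gr} (h : Between p q W) : InDisc (p * q) :=
  h.inDisc_left.mul h.inDisc_right

theorem Between.conductor_mul {p q : ℂ[X]} {W : Gr} (h : Between p q W) {f : C(S1, ℂ)}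
    (hf : f ∈ discAlgebra) {w : H} (hw : w ∈ W) :
    ∃ k ∈ Hplus, mulOp (polyS1 (p * q) * f) w = mulOp (polyS1 p) k := by
  refine ⟨_, hf _ (h.upper w hw), ?_⟩
  rw [← mulOp_mul, ← mulOp_mul, map_mul]
  congr 2
  ring

theorem Between.conductor_mul_mem {p q : ℂ[X]} {W : Gr} (h : Between p q W) {f : C(S1, ℂ)}
    (hf : f ∈ discAlgebra) {w : H} (hw : w ∈ W) : mulOp (polyS1 (p * q) * f) w ∈ W := by
  obtain ⟨k, hk, e⟩ := h.conductor_mul hf hw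
  rw [e]; exact h.lower k hk

/-- Up to `p H₊`, every element of `W` has finite order. -/
theorem Between.exists_finiteOrder_add {p q : ℂ[X]} {W : Gr} (h : Between p q W) {w : H}
    (hw : w ∈ W) : ∃ (r : ℂ[X]) (e k : H), r.degree < (p * q).degree ∧ e ∈ algPart W ∧
      k ∈ Hplus ∧ mulOp (polyS1 q) e = ofC (polyS1 r) ∧ w = e + mulOp (polyS1 p) k := by
  obtain ⟨r, k, hr, hk, hrk⟩ := h.inDisc_mul.exists_eq_poly_add _ (h.upper w hw)
  have he : mulOp (polyS1 q) (w - mulOp (polyS1 p) k) = ofC (polyS1 r) := by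
    rw [map_sub (mulOp _), hrk, ← mulOp_mul, ← map_mul, mul_comm q, add_sub_cancel_right]
  refine ⟨r, w - mulOp (polyS1 p) k, k, hr, ⟨W.toSubmodule.sub_mem hw (h.lower k hk), ?_⟩, hk, he, by abel⟩
  exact h.inDisc_right.mem_finiteOrder (by rw [he]; exact poly_mem_finiteOrder r)

/-- `W` is the sum of its finite-order part and `p H₊`, and every polynomial preserves `p H₊`. -/
theorem Between.mem_spectralRing {p q : ℂ[X]} {W : Gr} (h : Between p q W) {r : ℂ[X]} :
    r ∈ spectralRing W ↔ ∀ w ∈ W, mulOp (polyS1 r) w ∈ W := by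
  constructor
  · intro hr w hw
    obtain ⟨_, e, k, -, he, hk, -, rfl⟩ := h.exists_finiteOrder_add hw
    rw [map_add (mulOp _), mulOp_comm _ (polyS1 p)]
    exact add_mem (hr e he).1 (h.lower _ (polyS1_mem_discAlgebra r k hk))
  · intro hr w hw
    exact ⟨hr w hw.1, poly_mul_mem_finiteOrder r hw.2⟩

/-- For `f` in `A_W` the element `f ^ n p` lies in `algPart W`, so `f ^ n p q` lies in `H₊` and has
finite order: it is a polynomial for every `n`. -/
theorem Between.multiplierRing_eq {p q : ℂ[X]} {W : Gr} (h : Between p q W) :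
    multiplierRing W = (spectralRing W).map polyS1 := by
  ext f
  constructor
  · intro hf
    obtain ⟨u, rfl⟩ := eq_polyS1_of_forall_pow h.inDisc_mul (f := f) fun n => by
      have hp : ofC (polyS1 p) ∈ algPart W := by
        refine ⟨?_, poly_mem_finiteOrder p⟩
        rw [ofC_eq_mulOp]
        exact h.lower _ one_mem_Hplus
      have h1 := pow_mem hf n _ hp
      have e : ofC (f ^ n * polyS1 (p * q)) =
          mulOp (polyS1 q) (mulOp (f ^ n) (ofC (polyS1 p))) := by
        rw [mulOp_ofC, mulOp_ofC, map_mul polyS1]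
        congr 1
        ring
      refine eq_polyS1_of_finiteOrder ?_ ?_
      · rw [e]; exact h.upper _ h1.1
      · rw [e]; exact poly_mul_mem_finiteOrder q h1.2
    exact ⟨u, hf, rfl⟩
  · rintro ⟨u, hu, rfl⟩
    exact hu

/-- The product `h⁻¹ g` stabilises `W`. Writing `g ^ n = h ^ n (h⁻¹ g) ^ n` puts `g ^ n p q` in
`H₊`; it has finite order because `g ^ n` has no positive powers of `z`. So `g` is a polynomial, and
its coefficients in degrees `n ≥ 0` are those of 1. -/
theorem Between.GammaMinus_eq_one {p q : ℂ[X]} {W : Gr} (hB : Between p q W) {g h : C(S1, ℂ)ˣ}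
    (hg : g ∈ GammaMinus) (hh : h ∈ GammaPlus) (e : h • W = g • W) : g = 1 := by
  have e1 : (h⁻¹ * g) • W = W := by rw [mul_smul, ← e, inv_smul_smul]
  have e2 : ∀ n : ℕ, (h⁻¹ * g) ^ n • W = W := by
    intro n
    induction n with
    | zero => rw [pow_zero, one_smul]
    | succ n ih => rw [pow_succ, mul_smul, e1, ih]
  obtain ⟨u, hu⟩ := eq_polyS1_of_forall_pow hB.inDisc_mul (f := (g : C(S1, ℂ))) fun n => by
    have e3 : ofC ((g : C(S1, ℂ)) ^ n * polyS1 (p * q)) =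
        mulOp ((h ^ n : C(S1, ℂ)ˣ) : C(S1, ℂ)) (mulOp (polyS1 q)
          (mulOp (((h⁻¹ * g) ^ n : C(S1, ℂ)ˣ) : C(S1, ℂ)) (mulOp (polyS1 p) (ofC 1)))) := by
      have : g ^ n = h ^ n * (h⁻¹ * g) ^ n := by
        have := mul_pow h (h⁻¹ * g) n
        rwa [mul_inv_cancel_left] at this
      rw [← Units.val_pow_eq_pow_val, this, mulOp_ofC, mulOp_ofC, mulOp_ofC, mulOp_ofC,
        map_mul polyS1, Units.val_mul]
      congr 1
      ring
    refine eq_polyS1_of_finiteOrder ?_ ?_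
    · rw [e3]
      refine GammaPlus.mem_discAlgebra (pow_mem hh n) _ (hB.upper _ ?_)
      have := mulOp_mem_smul ((h⁻¹ * g) ^ n) (hB.lower _ one_mem_Hplus)
      rwa [e2] at this
    · rw [mul_comm, ← mulOp_ofC]
      refine poly_mul_mem_finiteOrder _ ⟨0, fun k hk => ?_⟩
      obtain ⟨j, rfl⟩ := Int.eq_ofNat_of_zero_le hk.le
      rw [← Units.val_pow_eq_pow_val, GammaMinus.coeffH (pow_mem hg n),
        if_neg (by simpa using hk.ne')]
  have h1 : u = 1 := by
    ext n
    rw [← coeffH_poly, ← hu, GammaMinus.coeffH hg, coeff_one]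
  ext1
  rw [hu, h1, map_one, Units.val_one]

/-! ### Divisor classes of polynomials -/

theorem sum_map_single_apply (s : Multiset ℂ) (c : ℂ) :
    (s.map fun c : ℂ => Finsupp.single (c : OnePoint ℂ) (1 : ℤ)).sum (c : OnePoint ℂ) =
      s.count c := by
  classical
  induction s using Multiset.induction_on with
  | empty => simp
  | cons a s ih =>
    rw [Multiset.map_cons, Multiset.sum_cons, Finsupp.add_apply, ih, Multiset.count_cons,
      Finsupp.single_apply]
    by_cases h : c = a
    · simp [h, add_comm]
    · have h' : ¬ (a : OnePoint ℂ) = c := fun e => h (OnePoint.coe_injective e).symm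
      simp [h, h']

theorem polyDiv_apply (u : ℂ[X]) (c : ℂ) : polyDiv u (c : OnePoint ℂ) = u.roots.count c := by
  classical
  rw [polyDiv, Finsupp.sub_apply, sum_map_single_apply, Finsupp.single_apply,
    if_neg (OnePoint.infty_ne_coe c), sub_zero]

theorem polyDiv_sum (u : ℂ[X]) : ((polyDiv u).sum fun _ n => n) = 0 := by
  have key : ∀ s : Multiset ℂ,
      ((s.map fun c : ℂ => Finsupp.single (c : OnePoint ℂ) (1 : ℤ)).sum.sum fun _ n => n) =
        Multiset.card s := by
    intro s
    induction s using Multiset.induction_on with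
    | empty => simp
    | cons a s ih =>
      rw [Multiset.map_cons, Multiset.sum_cons, Finsupp.sum_add_index' (by simp) (by simp), ih,
        Finsupp.sum_single_index rfl, Multiset.card_cons]
      push_cast; ring
  rw [polyDiv, sub_eq_add_neg, ← Finsupp.single_neg,
    Finsupp.sum_add_index' (by simp) (by simp), key, Finsupp.sum_single_index rfl,
    (IsAlgClosed.splits u).natDegree_eq_card_roots, add_neg_cancel]

theorem polyDiv_C_mul {a : ℂ} (ha : a ≠ 0) (u : ℂ[X]) : polyDiv (C a * u) = polyDiv u := by
  rw [polyDiv, polyDiv, roots_C_mul _ ha, natDegree_C_mul ha]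

theorem polyDiv_mem_divZero {A : Subalgebra ℂ ℂ[X]} {u : ℂ[X]}
    (h : ∀ c ∈ singularSet A, u.eval c ≠ 0) : polyDiv u ∈ divZero A := by
  refine ⟨fun c hc => ?_, polyDiv_sum u⟩
  rw [polyDiv_apply, Multiset.count_eq_zero_of_notMem, Nat.cast_zero]
  exact fun hm => h c hc (isRoot_of_mem_roots hm)

theorem eq_C_mul_of_polyDiv_eq {u v : ℂ[X]} (hv : v ≠ 0)
    (h : polyDiv u = polyDiv v) : ∃ a, u = C a * v := by
  have hr : u.roots = v.roots := by
    ext c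
    have := polyDiv_apply u c
    rw [h, polyDiv_apply] at this
    exact_mod_cast this.symm
  have h1 := (IsAlgClosed.splits u).eq_prod_roots
  have h2 := (IsAlgClosed.splits v).eq_prod_roots
  rw [hr] at h1
  refine ⟨u.leadingCoeff / v.leadingCoeff, ?_⟩
  calc u = C (u.leadingCoeff / v.leadingCoeff * v.leadingCoeff) *
        (v.roots.map fun x => X - C x).prod := by
        rwa [div_mul_cancel₀ _ (leadingCoeff_ne_zero.2 hv)]
    _ = _ := by rw [C_mul, mul_assoc, ← h2]

/-! ### Classes of polynomials in the generalized Jacobian, and the conductor -/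

section ZeroClass

variable {A : Subalgebra ℂ ℂ[X]} {u v : ℂ[X]} {x y : GenJacobian A}

theorem IsZeroClass.eval_ne_zero (h : IsZeroClass A u x) : ∀ c ∈ singularSet A, u.eval c ≠ 0 := by
  intro c hc h0
  obtain ⟨hu, hd, -⟩ := h
  have := hd.1 c hc
  rw [polyDiv_apply, Nat.cast_eq_zero, Multiset.count_eq_zero] at this
  exact this ((mem_roots hu).2 h0)

theorem exists_isZeroClass (hu : u ≠ 0) (h : ∀ c ∈ singularSet A, u.eval c ≠ 0) :
    ∃ x, IsZeroClass A u x := ⟨_, hu, polyDiv_mem_divZero h, rfl⟩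

theorem IsZeroClass.unique (h : IsZeroClass A u x) (h' : IsZeroClass A u y) : x = y := by
  obtain ⟨_, _, rfl⟩ := h
  obtain ⟨_, _, rfl⟩ := h'
  rfl

theorem IsZeroClass.mul (h : IsZeroClass A u x) (h' : IsZeroClass A v y) :
    IsZeroClass A (u * v) (x + y) := by
  obtain ⟨hu, hdu, rfl⟩ := h
  obtain ⟨hv, hdv, rfl⟩ := h'
  have e := polyDiv_mul hu hv
  refine ⟨mul_ne_zero hu hv, by rw [e]; exact add_mem hdu hdv, ?_⟩
  rw [← QuotientAddGroup.mk_add]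
  congr 1
  exact Subtype.ext e.symm

theorem IsZeroClass.C_mul {a : ℂ} (ha : a ≠ 0) (h : IsZeroClass A u x) :
    IsZeroClass A (C a * u) x := by
  obtain ⟨hu, hdu, rfl⟩ := h
  have e := polyDiv_C_mul ha u
  refine ⟨mul_ne_zero (C_ne_zero.2 ha) hu, by rwa [e], ?_⟩
  congr 1
  exact Subtype.ext e.symm

theorem IsSingUnit.isZeroClass_zero (h : IsSingUnit A u) : IsZeroClass A u 0 := by
  refine ⟨h.2.1, polyDiv_mem_divZero h.2.2, ?_⟩
  symm
  rw [QuotientAddGroup.eq_zero_iff, AddSubgroup.mem_addSubgroupOf]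
  refine ⟨u, 1, h, ⟨A.one_mem, one_ne_zero, by simp⟩, ?_⟩
  simp [polyDiv]

/-- A generator of the conductor of `A` in `ℂ[z]`, the zeros of which are the singular points. -/
structure IsConductor (A : Subalgebra ℂ ℂ[X]) (m₀ : ℂ[X]) : Prop where
  ne_zero : m₀ ≠ 0
  mul_mem : ∀ f, m₀ * f ∈ A
  mem_singularSet : ∀ c, c ∈ singularSet A ↔ m₀.eval c = 0

/-- The conductor is an ideal of the principal ideal domain `ℂ[z]`, and `m` belongs to it. -/
theorem exists_isConductor {m : ℂ[X]} (hm : m ≠ 0) (h : ∀ f, m * f ∈ A) :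
    ∃ m₀, IsConductor A m₀ ∧ m₀ ∣ m := by
  let I : Ideal ℂ[X] :=
    { carrier := {b | ∀ f, b * f ∈ A}
      zero_mem' := fun f => by rw [zero_mul]; exact A.zero_mem
      add_mem' := fun ha hb f => by rw [add_mul]; exact A.add_mem (ha f) (hb f)
      smul_mem' := fun c b hb f => by
        rw [smul_eq_mul, mul_comm c, mul_assoc]; exact hb (c * f) }
  have hI := fun b => (Submodule.IsPrincipal.mem_iff_generator_dvd I (x := b))
  have hg : Submodule.IsPrincipal.generator I ∈ I := Submodule.IsPrincipal.generator_mem I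
  have hgm := (hI m).1 h
  refine ⟨_, ⟨ne_zero_of_dvd_ne_zero hm hgm, hg, fun c => ⟨fun hc => ?_, fun hc b hb hbf => ?_⟩⟩,
    hgm⟩
  · exact hc _ (by simpa using hg 1) hg
  · exact eval_eq_zero_of_dvd_of_eval_eq_zero ((hI b).1 hbf) hc

theorem isCoprime_of_eval_ne_zero {m u : ℂ[X]} (h : ∀ c, m.eval c = 0 → u.eval c ≠ 0) :
    IsCoprime u m := by
  rw [isCoprime_iff_aeval_ne_zero_of_isAlgClosed ℂ ℂ]
  intro c
  simp only [coe_aeval_eq_eval]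
  by_cases hc : m.eval c = 0
  · exact Or.inl (h c hc)
  · exact Or.inr hc

theorem exists_inverse_mod {m u : ℂ[X]} (h : ∀ c, m.eval c = 0 → u.eval c ≠ 0) :
    ∃ v, v ≠ 0 ∧ m ∣ u * v - 1 := by
  obtain ⟨a, b, hab⟩ := isCoprime_of_eval_ne_zero h
  -- The inverse must be a non-zero polynomial to have a divisor. If the Bézout coefficient is zero,
  -- `m` is a unit and any choice will do.
  by_cases ha : a = 0
  · refine ⟨1, one_ne_zero, ?_⟩
    rw [ha, zero_mul, zero_add] at hab
    exact (IsUnit.of_mul_eq_one_right b hab).dvd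
  · exact ⟨a, ha, -b, by linear_combination hab⟩

theorem eval_ne_zero_of_dvd_mul_sub_one {m u v : ℂ[X]} (h : m ∣ u * v - 1) {c : ℂ}
    (hc : m.eval c = 0) : v.eval c ≠ 0 := by
  intro h0
  have := eval_eq_zero_of_dvd_of_eval_eq_zero h hc
  simp [h0] at this

theorem IsConductor.mem_of_dvd_sub {m₀ : ℂ[X]} (hA : IsConductor A m₀) (hu : u ∈ A) (h : m₀ ∣ v - u) : v ∈ A := by
  obtain ⟨k, hk⟩ := h
  rw [sub_eq_iff_eq_add.1 hk]
  exact A.add_mem (hA.mul_mem k) hu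

theorem IsConductor.isSingUnit {m₀ : ℂ[X]} (hA : IsConductor A m₀) (hu : IsSingUnit A u)
    (hv : v ≠ 0) (h : m₀ ∣ v - u) : IsSingUnit A v := by
  refine ⟨hA.mem_of_dvd_sub hu.1 h, hv, fun c hc => ?_⟩
  have := eval_eq_zero_of_dvd_of_eval_eq_zero h ((hA.mem_singularSet c).1 hc)
  rw [eval_sub, sub_eq_zero] at this
  rw [this]
  exact hu.2.2 c hc

theorem IsSingUnit.one : IsSingUnit A 1 := ⟨A.one_mem, one_ne_zero, by simp⟩

theorem IsConductor.exists_inverse_class {m₀ : ℂ[X]} (hA : IsConductor A m₀)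
    (h : IsZeroClass A u x) : ∃ v, m₀ ∣ u * v - 1 ∧ IsZeroClass A v (-x) := by
  obtain ⟨v, hv, hd⟩ := exists_inverse_mod (m := m₀) (u := u) fun c hc =>
    h.eval_ne_zero c ((hA.mem_singularSet c).2 hc)
  obtain ⟨y, hy⟩ := exists_isZeroClass (A := A) hv fun c hc =>
    eval_ne_zero_of_dvd_mul_sub_one hd ((hA.mem_singularSet c).1 hc)
  have h1 := (h.mul hy).unique
    (hA.isSingUnit .one (mul_ne_zero h.1 hv) hd).isZeroClass_zero
  rw [← neg_eq_of_add_eq_zero_right h1] at hy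
  exact ⟨v, hd, hy⟩

/-- An inverse `w` of `u` modulo `m₀` is also one of `v`. A polynomial congruent to 1 modulo `m₀`
lies in `A` and does not vanish at the singular points, so its class is zero; hence `u` and `v` both
have the class opposite to that of `w`. -/
theorem IsConductor.isZeroClass_congr {m₀ : ℂ[X]} (hA : IsConductor A m₀)
    (h : IsZeroClass A u x) (hv : v ≠ 0) (hd : m₀ ∣ v - u) : IsZeroClass A v x := by
  obtain ⟨w, hw, hwx⟩ := hA.exists_inverse_class h
  obtain ⟨y, hy⟩ := exists_isZeroClass (A := A) hv fun c hc => by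
    have := eval_eq_zero_of_dvd_of_eval_eq_zero hd ((hA.mem_singularSet c).1 hc)
    rw [eval_sub, sub_eq_zero] at this
    rw [this]
    exact h.eval_ne_zero c hc
  have h1 : m₀ ∣ v * w - 1 := by
    have : v * w - 1 = (v - u) * w + (u * w - 1) := by ring
    rw [this]
    exact dvd_add (hd.mul_right w) hw
  have h2 := (hy.mul hwx).unique
    (hA.isSingUnit .one (mul_ne_zero hv hwx.1) h1).isZeroClass_zero
  rwa [add_neg_eq_zero.1 h2] at hy

/-- An inverse of the Cayley–Hamilton type: `f = ∏ (T - u(c))`, over the roots `c` of `m₀`,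
satisfies `m₀ ∣ f(u)` and has non-zero constant term. Solving for that term expresses the inverse as
a polynomial in `u`, which keeps it in `A`. -/
theorem IsConductor.exists_inverse_mem {m₀ : ℂ[X]} (hA : IsConductor A m₀)
    (h : IsSingUnit A u) : ∃ v ∈ A, m₀ ∣ u * v - 1 := by
  set f : ℂ[X] := (m₀.roots.map fun c => X - C (u.eval c)).prod with hf
  have h0 : f.coeff 0 ≠ 0 := by
    rw [coeff_zero_eq_eval_zero, hf, eval_multiset_prod, Multiset.map_map]
    intro h0
    rw [Multiset.prod_eq_zero_iff, Multiset.mem_map] at h0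
    obtain ⟨c, hc, h0⟩ := h0
    simp only [Function.comp_apply, eval_sub, eval_X, eval_C, zero_sub, neg_eq_zero] at h0
    exact h.2.2 c ((hA.mem_singularSet c).2 (isRoot_of_mem_roots hc)) h0
  have h1 : m₀ ∣ aeval u f := by
    rw [hf, map_multiset_prod, Multiset.map_map]
    have h2 := (IsAlgClosed.splits m₀).eq_prod_roots
    have h3 : (m₀.roots.map fun c => X - C c).prod ∣
        (m₀.roots.map ((aeval u) ∘ fun c => X - C (u.eval c))).prod := by
      refine Multiset.prod_dvd_prod_of_dvd _ _ fun c _ => ?_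
      simp only [Function.comp_apply, map_sub, aeval_X, aeval_C, algebraMap_eq]
      exact X_sub_C_dvd_sub_C_eval
    rw [h2, (isUnit_C.2 (leadingCoeff_ne_zero.2 hA.ne_zero).isUnit).mul_left_dvd]
    rwa [← h2]
  have h4 : aeval u f = aeval u f.divX * u + C (f.coeff 0) := by
    conv_lhs => rw [← divX_mul_X_add f]
    simp
  refine ⟨C (-(f.coeff 0)⁻¹) * aeval u f.divX, A.mul_mem (A.algebraMap_mem _)
    (Algebra.adjoin_le (by simpa using h.1) (aeval_mem_adjoin_singleton ℂ u)), ?_⟩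
  have h5 : u * (C (-(f.coeff 0)⁻¹) * aeval u f.divX) - 1 =
      C (-(f.coeff 0)⁻¹) * aeval u f := by
    have : (C (f.coeff 0)⁻¹ : ℂ[X]) * C (f.coeff 0) = 1 := by
      rw [← C_mul, inv_mul_cancel₀ h0, C_1]
    rw [h4, C_neg]
    linear_combination this
  rw [h5]
  exact h1.mul_left _

/-- If `div u = div a - div b`, then `u b = l a` for a constant `l`. With an inverse `b'` of `b`
modulo `m₀` taken in `A`, `u` is congruent to `l a b'`, which is in `A`. -/
theorem IsConductor.mem_of_isZeroClass_zero {m₀ : ℂ[X]} (hA : IsConductor A m₀)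
    (h : IsZeroClass A u 0) : u ∈ A := by
  obtain ⟨hu, hd, h0⟩ := h
  rw [eq_comm, QuotientAddGroup.eq_zero_iff, AddSubgroup.mem_addSubgroupOf] at h0
  obtain ⟨a, b, ha, hb, hab⟩ := h0
  change polyDiv u = polyDiv a - polyDiv b at hab
  rw [eq_sub_iff_add_eq, ← polyDiv_mul hu hb.2.1] at hab
  obtain ⟨l, hl⟩ := eq_C_mul_of_polyDiv_eq ha.2.1 hab
  obtain ⟨b', hb', hbb'⟩ := hA.exists_inverse_mem hb
  refine hA.mem_of_dvd_sub (A.mul_mem (A.mul_mem (A.algebraMap_mem l) ha.1) hb') ?_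
  have : u - algebraMap ℂ ℂ[X] l * a * b' = -u * (b * b' - 1) := by
    rw [algebraMap_eq, ← hl]; ring
  rw [this]
  exact hbb'.mul_left _

/-- The classes of polynomials form a subgroup, closed under negation thanks to inverses modulo
`m₀`. It contains each `(c) - (∞)`, the class of `X - c`, and a divisor of degree zero is a
combination of these. -/
theorem IsConductor.exists_isZeroClass {m₀ : ℂ[X]} (hA : IsConductor A m₀)
    (x : GenJacobian A) : ∃ u, IsZeroClass A u x := by
  let K : AddSubgroup (GenJacobian A) :=
    { carrier := {x | ∃ u, IsZeroClass A u x}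
      zero_mem' := ⟨1, IsSingUnit.one.isZeroClass_zero⟩
      add_mem' := by rintro _ _ ⟨u, hu⟩ ⟨v, hv⟩; exact ⟨u * v, hu.mul hv⟩
      neg_mem' := by
        rintro x ⟨u, hu⟩
        obtain ⟨v, -, hv⟩ := hA.exists_inverse_class hu
        exact ⟨v, hv⟩ }
  change x ∈ K
  obtain ⟨⟨D, hD⟩, rfl⟩ := QuotientAddGroup.mk_surjective x
  have hpt : ∀ P : OnePoint ℂ, D P ≠ 0 → ∃ h : Finsupp.single P (1 : ℤ) -
      Finsupp.single OnePoint.infty 1 ∈ divZero A,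
      (QuotientAddGroup.mk ⟨_, h⟩ : GenJacobian A) ∈ K := by
    intro P hP
    induction P using OnePoint.rec with
    | infty =>
      refine ⟨by rw [sub_self]; exact zero_mem _, ?_⟩
      convert K.zero_mem
      rw [QuotientAddGroup.eq_zero_iff]
      simp only [sub_self]
      exact zero_mem _
    | coe c =>
      have hc : ∀ d ∈ singularSet A, (X - C c : ℂ[X]).eval d ≠ 0 := by
        intro d hd h0
        rw [eval_sub, eval_X, eval_C, sub_eq_zero] at h0
        exact hP (hD.1 c (h0 ▸ hd))
      have e : polyDiv (X - C c) = Finsupp.single (c : OnePoint ℂ) (1 : ℤ) -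
          Finsupp.single OnePoint.infty 1 := by
        simp [polyDiv]
      refine ⟨e ▸ polyDiv_mem_divZero hc, X - C c, X_sub_C_ne_zero c, polyDiv_mem_divZero hc, ?_⟩
      congr 1
      exact Subtype.ext e.symm
  choose h hK using hpt
  have hDsum : (⟨D, hD⟩ : divZero A) = ∑ P ∈ D.support.attach, D P.1 •
      (⟨_, h P.1 (Finsupp.mem_support_iff.1 P.2)⟩ : divZero A) := by
    apply Subtype.ext
    rw [AddSubgroup.val_finsetSum]
    simp only [AddSubgroup.coe_zsmul]
    rw [Finset.sum_attach D.support fun P => D P • (Finsupp.single P (1 : ℤ) -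
      Finsupp.single OnePoint.infty 1)]
    simp only [smul_sub, Finset.sum_sub_distrib, ← Finset.sum_smul]
    have h1 : ∑ P ∈ D.support, D P = 0 := hD.2
    rw [h1, zero_smul, sub_zero]
    simp only [Finsupp.smul_single, smul_eq_mul, mul_one]
    exact (Finsupp.sum_single D).symm
  rw [hDsum]
  have hmk : ∀ y : divZero A, (QuotientAddGroup.mk y : GenJacobian A) =
    QuotientAddGroup.mk' ((principalDiv A).addSubgroupOf (divZero A)) y := fun _ => rfl
  rw [hmk, map_sum]
  refine sum_mem fun P _ => ?_
  rw [map_zsmul]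
  exact zsmul_mem (hK P.1 (Finsupp.mem_support_iff.1 P.2)) _

end ZeroClass

/-! ### The orbit and the generalized Jacobian -/

/-- `g ≡ u` modulo `m`, in the algebra of functions preserving `H₊`. -/
def IsResidue (m : ℂ[X]) (g : C(S1, ℂ)) (u : ℂ[X]) : Prop :=
  ∃ h ∈ discAlgebra, g = polyS1 u + polyS1 m * h

theorem IsResidue.mul {m : ℂ[X]} {f g : C(S1, ℂ)} {u v : ℂ[X]} (hf : IsResidue m f u)
    (hg : IsResidue m g v) : IsResidue m (f * g) (u * v) := by
  obtain ⟨h, hh, rfl⟩ := hf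
  obtain ⟨k, hk, rfl⟩ := hg
  refine ⟨polyS1 u * k + polyS1 v * h + polyS1 m * h * k, ?_, by rw [map_mul]; ring⟩
  exact add_mem (add_mem (mul_mem (polyS1_mem_discAlgebra u) hk)
    (mul_mem (polyS1_mem_discAlgebra v) hh)) (mul_mem (mul_mem (polyS1_mem_discAlgebra m) hh) hk)

theorem IsResidue.dvd_sub {m : ℂ[X]} (hm : InDisc m) {g : C(S1, ℂ)} {u v : ℂ[X]}
    (hu : IsResidue m g u) (hv : IsResidue m g v) : m ∣ v - u := by
  obtain ⟨h, hh, rfl⟩ := hu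
  obtain ⟨k, hk, e⟩ := hv
  refine hm.dvd_of_eq_mul (sub_mem hh hk) ?_
  rw [map_sub]
  linear_combination -e

theorem IsResidue.add_mul {m : ℂ[X]} {g : C(S1, ℂ)} {u : ℂ[X]} (hu : IsResidue m g u)
    (k : ℂ[X]) : IsResidue m g (u + m * k) := by
  obtain ⟨h, hh, rfl⟩ := hu
  refine ⟨h - polyS1 k, sub_mem hh (polyS1_mem_discAlgebra k), ?_⟩
  rw [map_add, map_mul]; ring

theorem isResidue_polyS1 (m u : ℂ[X]) : IsResidue m (polyS1 u) u :=
  ⟨0, zero_mem _, by rw [mul_zero, add_zero]⟩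

theorem exists_isResidue {m : ℂ[X]} (hm : InDisc m) {g : C(S1, ℂ)} (hg : g ∈ discAlgebra) :
    ∃ u, u ≠ 0 ∧ IsResidue m g u := by
  obtain ⟨u, h, hh, e⟩ := hm.exists_eq_poly_add_mul hg
  by_cases hu : u = 0
  · refine ⟨u + m * 1, ?_, IsResidue.add_mul ⟨h, hh, e⟩ 1⟩
    rw [hu, zero_add, mul_one]
    exact hm.1.ne_zero
  · exact ⟨u, hu, h, hh, e⟩

theorem IsResidue.eval_ne_zero {m : ℂ[X]} (hm : InDisc m) {g : C(S1, ℂ)ˣ} (hg : g ∈ GammaPlus)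
    {u : ℂ[X]} (hu : IsResidue m (g : C(S1, ℂ)) u) {c : ℂ} (hc : m.eval c = 0) :
    u.eval c ≠ 0 := by
  obtain ⟨v, -, hv⟩ := exists_isResidue hm (GammaPlus.mem_discAlgebra (inv_mem hg))
  have h1 := hu.mul hv
  rw [Units.mul_inv] at h1
  have h2 := IsResidue.dvd_sub hm (isResidue_polyS1 m 1) (by rwa [map_one])
  exact fun h0 => eval_ne_zero_of_dvd_mul_sub_one (u := v) (v := u) (by rwa [mul_comm]) hc h0

theorem Between.residue_mul {p q : ℂ[X]} {V : Gr} (hB : Between p q V) {g : C(S1, ℂ)} {u : ℂ[X]}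
    (hu : IsResidue (p * q) g u) {w : H} (hw : w ∈ V) :
    ∃ k ∈ Hplus, mulOp g w = mulOp (polyS1 u) w + mulOp (polyS1 p) k := by
  obtain ⟨h, hh, rfl⟩ := hu
  obtain ⟨k, hk, e⟩ := hB.conductor_mul hh hw
  exact ⟨k, hk, by rw [mulOp_add_apply, e]⟩

theorem Between.mul_mem_spectralRing {p q : ℂ[X]} {W : Gr} (hB : Between p q W) (f : ℂ[X]) :
    p * q * f ∈ spectralRing W := by
  rw [hB.mem_spectralRing]
  intro w hw
  rw [map_mul]
  exact hB.conductor_mul_mem (polyS1_mem_discAlgebra f) hw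

theorem Between.exists_isConductor {p q : ℂ[X]} {W : Gr} (hB : Between p q W) :
    ∃ m₀, IsConductor (spectralRing W) m₀ ∧ m₀ ∣ p * q :=
  KPOrbit.exists_isConductor hB.inDisc_mul.1.ne_zero hB.mul_mem_spectralRing

/-- The properties of the homomorphism from `Γ₊` to the generalized Jacobian which sends `g` to
the class of the divisor of a polynomial congruent to `g`. -/
structure IsJacobianMap (W : Gr) (m : ℂ[X])
    (ψ : GammaPlus → GenJacobian (spectralRing W)) : Prop where
  class_of_residue : ∀ (g : GammaPlus) (u : ℂ[X]), u ≠ 0 → IsResidue m (g : C(S1, ℂ)ˣ) u →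
    IsZeroClass (spectralRing W) u (ψ g)
  class_mul : ∀ g h, ψ (g * h) = ψ g + ψ h
  eq_iff : ∀ g h, ψ g = ψ h ↔ g • W = h • W
  surjective : Function.Surjective ψ

/-- Add a multiple of `m₀` to make a polynomial prime to `m`. -/
theorem exists_add_mul_eval_ne_zero {m₀ m u : ℂ[X]} (hm₀ : m₀ ≠ 0) (hm : m ≠ 0)
    (hu : ∀ c, m₀.eval c = 0 → u.eval c ≠ 0) :
    ∃ k, u + m₀ * k ≠ 0 ∧ ∀ c, m.eval c = 0 → (u + m₀ * k).eval c ≠ 0 := by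
  classical
  obtain ⟨k, hk⟩ : ∃ k, ∀ c, m.eval c = 0 → (u + m₀ * k).eval c ≠ 0 := by
    -- At each root of `m` exactly one of `u` and `m₀ k` vanishes: `k` is zero where `u` is not, and
    -- where `u` is zero neither `k` nor `m₀` is.
    refine ⟨∏ c ∈ m.roots.toFinset with u.eval c ≠ 0, (X - C c), fun c hc => ?_⟩
    rw [eval_add, eval_mul, eval_prod]
    by_cases huc : u.eval c = 0
    · rw [huc, zero_add]
      refine mul_ne_zero (fun h => hu c h huc) (Finset.prod_ne_zero_iff.2 fun d hd h0 => ?_)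
      rw [eval_sub, eval_X, eval_C, sub_eq_zero] at h0
      exact (Finset.mem_filter.1 hd).2 (h0 ▸ huc)
    · rw [Finset.prod_eq_zero (i := c)]
      · rwa [mul_zero, add_zero]
      · simp [hm, hc, huc]
      · simp
  by_cases h0 : u + m₀ * k = 0
  · refine ⟨k + m, ?_, fun c hc => ?_⟩
    · rw [mul_add, ← add_assoc, h0, zero_add]
      exact mul_ne_zero hm₀ hm
    · rw [mul_add, ← add_assoc, eval_add, eval_mul, hc, mul_zero, add_zero]
      exact hk c hc
  · exact ⟨k, h0, hk⟩

/-- If `g ≡ u` modulo `m`, then `g w` and `u w` differ by an element of `p H₊ ⊆ W`, for every `w` in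
`W`. So `g W ⊆ W` if and only if `u ∈ A`, that is, if and only if the class of `u` is zero. -/
theorem exists_isJacobianMap {p q : ℂ[X]} {W : Gr} (hB : Between p q W) :
    ∃ ψ, IsJacobianMap W (p * q) ψ := by
  obtain ⟨m₀, hA, hdvd⟩ := hB.exists_isConductor
  have hm := hB.inDisc_mul
  set m := p * q
  have hroot : ∀ {c}, c ∈ singularSet (spectralRing W) → m.eval c = 0 := fun hc =>
    eval_eq_zero_of_dvd_of_eval_eq_zero hdvd ((hA.mem_singularSet _).1 hc)
  have hex : ∀ g : GammaPlus, ∃ x, ∀ u, u ≠ 0 → IsResidue m (g : C(S1, ℂ)ˣ) u →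
      IsZeroClass (spectralRing W) u x := by
    intro g
    obtain ⟨u, hu, hgu⟩ := exists_isResidue hm (GammaPlus.mem_discAlgebra g.2)
    obtain ⟨x, hx⟩ := exists_isZeroClass (A := spectralRing W) hu fun c hc =>
      hgu.eval_ne_zero hm g.2 (hroot hc)
    exact ⟨x, fun v hv hgv => hA.isZeroClass_congr hx hv (hdvd.trans (hgu.dvd_sub hm hgv))⟩
  choose ψ hψ using hex
  have hmul : ∀ g h, ψ (g * h) = ψ g + ψ h := by
    intro g h
    obtain ⟨u, hu, hgu⟩ := exists_isResidue hm (GammaPlus.mem_discAlgebra g.2)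
    obtain ⟨v, hv, hhv⟩ := exists_isResidue hm (GammaPlus.mem_discAlgebra h.2)
    exact (hψ (g * h) (u * v) (mul_ne_zero hu hv) (hgu.mul hhv)).unique
      ((hψ g u hu hgu).mul (hψ h v hv hhv))
  have hone : ψ 1 = 0 := by
    have := hmul 1 1
    rwa [mul_one, left_eq_add] at this
  have hle : ∀ g, ψ g = 0 → ∀ w ∈ W, mulOp ((g : C(S1, ℂ)ˣ) : C(S1, ℂ)) w ∈ W := by
    intro g hg w hw
    obtain ⟨u, hu, hgu⟩ := exists_isResidue hm (GammaPlus.mem_discAlgebra g.2)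
    have h1 := hψ g u hu hgu
    rw [hg] at h1
    obtain ⟨k, hk, e⟩ := hB.residue_mul hgu hw
    rw [e]
    exact add_mem (hB.mem_spectralRing.1 (hA.mem_of_isZeroClass_zero h1) w hw) (hB.lower k hk)
  have hzero : ∀ g, ψ g = 0 ↔ g • W = W := by
    intro g
    constructor
    · intro hg
      have hg' : ψ g⁻¹ = 0 := by
        have := hmul g g⁻¹
        rwa [mul_inv_cancel, hone, hg, zero_add, eq_comm] at this
      ext v
      constructor
      · intro hv
        obtain ⟨w, hw, rfl⟩ := (mem_smul_iff (g : C(S1, ℂ)ˣ) W v).1 hv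
        exact hle g hg w hw
      · intro hv
        exact (mem_smul_iff (g : C(S1, ℂ)ˣ) W v).2 ⟨_, hle g⁻¹ hg' v hv,
          (mulOp_units_inv (g : C(S1, ℂ)ˣ) v).symm⟩
    · intro hg
      obtain ⟨u, hu, hgu⟩ := exists_isResidue hm (GammaPlus.mem_discAlgebra g.2)
      have hA' : u ∈ spectralRing W := by
        rw [hB.mem_spectralRing]
        intro w hw
        obtain ⟨k, hk, e⟩ := hB.residue_mul hgu hw
        have h1 := mulOp_mem_smul (g : C(S1, ℂ)ˣ) hw
        change _ ∈ g • W at h1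
        rw [hg, e] at h1
        have := W.toSubmodule.sub_mem h1 (hB.lower k hk)
        rwa [add_sub_cancel_right] at this
      exact (hψ g u hu hgu).unique (IsSingUnit.isZeroClass_zero
        ⟨hA', hu, fun c hc => hgu.eval_ne_zero hm g.2 (hroot hc)⟩)
  refine ⟨ψ, hψ, hmul, fun g h => ?_, fun x => ?_⟩
  · have h1 : ψ h = ψ g + ψ (g⁻¹ * h) := by rw [← hmul, mul_inv_cancel_left]
    have h2 := hzero (g⁻¹ * h)
    rw [mul_smul, inv_smul_eq_iff, eq_comm (a := h • W)] at h2
    rw [← h2, h1, left_eq_add]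
  · obtain ⟨u, hu⟩ := hA.exists_isZeroClass x
    -- The representative `u` is only known to be prime to `m₀`, whereas a residue of an element of
    -- `Γ₊` is prime to `m`; adding a multiple of `m₀` does not change the class.
    obtain ⟨k, h0, hk⟩ := exists_add_mul_eval_ne_zero hA.ne_zero hm.1.ne_zero fun c hc =>
      hu.eval_ne_zero c ((hA.mem_singularSet c).2 hc)
    obtain ⟨g, hg, a, ha, h, hh, e⟩ := exists_GammaPlus_eq hm _ hk
    refine ⟨⟨g, hg⟩, ?_⟩
    exact (hψ ⟨g, hg⟩ _ (mul_ne_zero (C_ne_zero.2 ha) h0) ⟨h, hh, e⟩).unique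
      ((hA.isZeroClass_congr hu h0 (by rw [add_sub_cancel_left]; exact dvd_mul_right _ _)).C_mul ha)

/-! ### Local algebras of functions -/

/-- Evaluation at a point, on an algebra of functions. -/
def evalAt {S : Type*} (R : Subalgebra ℂ (S → ℂ)) (x : S) : R →ₐ[ℂ] ℂ :=
  (Pi.evalAlgHom ℂ (fun _ : S => ℂ) x).comp R.val

theorem evalAt_apply {S : Type*} (R : Subalgebra ℂ (S → ℂ)) (x : S) (f : R) :
    evalAt R x f = f.1 x := rfl

/-- An algebra of functions in which a function that does not vanish at `x₀` is invertible
in the neighbourhoods of `x₀` given by the filter `l`. -/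
structure IsLocalAlgebra {S : Type*} (x₀ : S) (l : Filter S) (R : Subalgebra ℂ (S → ℂ)) :
    Prop where
  pure_le : pure x₀ ≤ l
  exists_inv : ∀ f : R, evalAt R x₀ f ≠ 0 → ∃ g : R, ∀ᶠ x in l, evalAt R x f * evalAt R x g = 1

section LocalAlgebra

variable {S : Type*} {x₀ : S} {l : Filter S} {R : Subalgebra ℂ (S → ℂ)}

theorem IsLocalAlgebra.eventually_ne_zero (hR : IsLocalAlgebra x₀ l R) (f : R)
    (hf : evalAt R x₀ f ≠ 0) : ∀ᶠ x in l, evalAt R x f ≠ 0 := by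
  obtain ⟨g, hg⟩ := hR.exists_inv f hf
  filter_upwards [hg] with x hx h0
  rw [h0, zero_mul] at hx
  exact zero_ne_one hx

theorem IsLocalAlgebra.exists_matrix_inv (hR : IsLocalAlgebra x₀ l R) {d : ℕ}
    (G : Matrix (Fin d) (Fin d) R) (hG : (G.map (evalAt R x₀)).det ≠ 0) :
    ∃ N : Matrix (Fin d) (Fin d) R,
      ∀ᶠ x in l, G.map (evalAt R x) * N.map (evalAt R x) = 1 := by
  have hdet : ∀ x, evalAt R x G.det = (G.map (evalAt R x)).det := fun x =>
    AlgHom.map_det (evalAt R x) G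
  obtain ⟨δ, hδ⟩ := hR.exists_inv G.det (by rwa [hdet])
  refine ⟨δ • G.adjugate, ?_⟩
  filter_upwards [hδ] with x hx
  have h1 : (G * (δ • G.adjugate)).map (evalAt R x) = 1 := by
    rw [Matrix.mul_smul, Matrix.mul_adjugate, smul_smul]
    ext i j
    simp only [Matrix.map_apply, Matrix.smul_apply, smul_eq_mul, map_mul, mul_comm] at hx ⊢
    rw [hx, mul_one, Matrix.one_apply, Matrix.one_apply]
    split_ifs <;> simp
  rwa [Matrix.map_mul] at h1

/-- A solution of a family of systems of linear equations, the rank of which does not jump,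
extends from `x₀` to a neighbourhood. -/
theorem IsLocalAlgebra.exists_solution (hR : IsLocalAlgebra x₀ l R) {P I : Type*}
    [AddCommGroup P] [Module ℂ P] [FiniteDimensional ℂ P] (φ : I → S → P →ₗ[ℂ] ℂ)
    (hφ : ∀ i u, (fun x => φ i x u) ∈ R) (K₀ : Submodule ℂ P)
    (hK₀ : ∀ u, (∀ i, φ i x₀ u = 0) ↔ u ∈ K₀) (u₀ : P) (hu₀ : u₀ ∈ K₀) :
    ∃ (r : ℕ) (e : Fin r → P) (a : Fin r → R), (∀ j, evalAt R x₀ (a j) = 0) ∧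
      ∀ᶠ x in l, ∀ K : Submodule ℂ P, (∀ u ∈ K, ∀ i, φ i x u = 0) →
        Module.finrank ℂ K₀ ≤ Module.finrank ℂ K → u₀ + ∑ j, evalAt R x (a j) • e j ∈ K := by
  -- The correction to `u₀` is sought in a complement `Q` of the solution space at `x₀`. There the
  -- system is injective, so its rows span all of `ℂ ^ r`, and `r` of them form a minor that is
  -- invertible at `x₀`, hence nearby.
  obtain ⟨Q, hQ⟩ := K₀.exists_isCompl
  set r := Module.finrank ℂ Q
  let b := Module.finBasis ℂ Q
  let e : Fin r → P := fun j => b j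
  let row : I → Fin r → ℂ := fun i j => φ i x₀ (e j)
  have hspan : Submodule.span ℂ (Set.range row) = ⊤ := by
    by_contra hne
    obtain ⟨f, hf, hle⟩ := Submodule.exists_le_ker_of_lt_top _ (lt_top_iff_ne_top.2 hne)
    set c : Fin r → ℂ := fun j => f (Pi.single j 1)
    have hfc : ∀ v, f v = ∑ j, c j * v j := fun v => by
      rw [LinearMap.pi_apply_eq_sum_univ f v]
      simp only [smul_eq_mul, c, mul_comm]
      congr 1
      ext j
      congr 2
      ext k
      simp [Pi.single_apply, eq_comm]
    have h1 : ∑ j, c j • e j ∈ K₀ := by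
      rw [← hK₀]
      intro i
      have h2 : f (row i) = 0 := hle (Submodule.subset_span ⟨i, rfl⟩)
      rw [hfc] at h2
      simpa [row] using h2
    have h3 : ∑ j, c j • e j = ((∑ j, c j • b j : Q) : P) := by simp [e]
    have h4 : ∑ j, c j • e j = 0 := by
      have := hQ.disjoint.le_bot (show ∑ j, c j • e j ∈ K₀ ⊓ Q from
        ⟨h1, by rw [h3]; exact Submodule.coe_mem _⟩)
      simpa using this
    rw [h3, Submodule.coe_eq_zero] at h4
    have h5 := Fintype.linearIndependent_iff.1 b.linearIndependent c h4
    exact hf (LinearMap.ext fun v => by rw [hfc]; simp [h5])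
  obtain ⟨f, hf, -, hlin⟩ := Submodule.exists_fun_fin_finrank_span_eq ℂ (Set.range row)
  have hr : r = Module.finrank ℂ (Submodule.span ℂ (Set.range row)) := by
    rw [hspan, finrank_top]; simp
  choose i hi using hf
  let ι : Fin r → I := fun k => i (Fin.cast hr k)
  let G : Matrix (Fin r) (Fin r) R := Matrix.of fun k j => ⟨_, hφ (ι k) (e j)⟩
  have hG : (G.map (evalAt R x₀)).det ≠ 0 := by
    have h1 : LinearIndependent ℂ (G.map (evalAt R x₀)).row := by
      have h2 : (G.map (evalAt R x₀)).row = f ∘ Fin.cast hr := by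
        ext k j
        rw [Function.comp_apply, ← hi]
        rfl
      rw [h2]
      exact hlin.comp (Fin.cast hr) (Fin.cast_injective hr)
    have h3 := Matrix.linearIndependent_rows_iff_isUnit.1 h1
    rw [Matrix.isUnit_iff_isUnit_det] at h3
    exact h3.ne_zero
  obtain ⟨N, hN⟩ := hR.exists_matrix_inv G hG
  let a : Fin r → R := fun j => -∑ k, N j k * ⟨_, hφ (ι k) u₀⟩
  have ha : ∀ x j, evalAt R x (a j) = -∑ k, evalAt R x (N j k) * φ (ι k) x u₀ := fun x j => by
    simp only [a, map_neg, map_sum, map_mul]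
    rfl
  refine ⟨r, e, a, fun j => ?_, ?_⟩
  · rw [ha]
    simp [(hK₀ u₀).2 hu₀]
  · filter_upwards [hN] with x hx K hK hrank
    let L : P →ₗ[ℂ] (Fin r → ℂ) := LinearMap.pi fun k => φ (ι k) x
    have hLe : ∀ c : Fin r → ℂ, L (∑ j, c j • e j) = (G.map (evalAt R x)).mulVec c := by
      intro c
      ext k
      simp only [L, LinearMap.pi_apply, map_sum, map_smul, Matrix.mulVec, dotProduct, smul_eq_mul]
      exact Finset.sum_congr rfl fun j _ => mul_comm _ _
    have hsurj : Function.Surjective L := fun y =>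
      ⟨_, (hLe ((N.map (evalAt R x)).mulVec y)).trans (by
        rw [Matrix.mulVec_mulVec, hx, Matrix.one_mulVec])⟩
    -- The `r` chosen equations cut out a space of dimension `dim K₀`. It contains `K`, whose
    -- dimension is at least that, so the remaining equations hold automatically.
    have hker : Module.finrank ℂ (LinearMap.ker L) = Module.finrank ℂ K₀ := by
      have h1 := L.finrank_range_add_finrank_ker
      rw [LinearMap.range_eq_top.2 hsurj, finrank_top, Module.finrank_fin_fun] at h1
      have h2 := Submodule.finrank_add_eq_of_isCompl hQ
      omega
    have hKL : K = LinearMap.ker L := Submodule.eq_of_le_of_finrank_le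
      (fun u hu => LinearMap.mem_ker.2 (funext fun k => hK u hu (ι k))) (by omega)
    rw [hKL, LinearMap.mem_ker, map_add, hLe]
    have h3 : (fun j => evalAt R x (a j)) = -(N.map (evalAt R x)).mulVec (L u₀) := by
      ext j
      rw [ha]
      rfl
    rw [h3, Matrix.mulVec_neg, Matrix.mulVec_mulVec, hx, Matrix.one_mulVec, add_neg_cancel]

end LocalAlgebra

/-! ### Charts of the Grassmannian along families of points of an orbit -/

theorem isClosed_poly_Hplus {p : ℂ[X]} (hp : InDisc p) :
    IsClosed ((Hplus.map (mulOp (polyS1 p)).toLinearMap : Submodule ℂ H) : Set H) := by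
  have h : ((Hplus.map (mulOp (polyS1 p)).toLinearMap : Submodule ℂ H) : Set H) =
      mulOp (invC _ hp.polyS1_ne_zero) ⁻¹' Hplus := by
    ext v
    simp only [Submodule.map_coe, Set.mem_image, SetLike.mem_coe, Set.mem_preimage,
      ContinuousLinearMap.coe_coe]
    constructor
    · rintro ⟨k, hk, rfl⟩
      rwa [← mulOp_mul, mul_comm, mul_invC, mulOp_one_apply]
    · intro hv
      exact ⟨_, hv, by rw [← mulOp_mul, mul_invC, mulOp_one_apply]⟩
  rw [h]
  exact isClosed_Hplus.preimage (mulOp _).continuous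

/-- The map `r ↦ r w` on polynomials. -/
noncomputable def polyAct (w : H) : ℂ[X] →ₗ[ℂ] H where
  toFun r := mulOp (polyS1 r) w
  map_add' r s := by rw [map_add, mulOp_add_apply]
  map_smul' c r := by rw [map_smul, mulOp_smul_apply]; rfl

theorem polyAct_apply (w : H) (r : ℂ[X]) : polyAct w r = mulOp (polyS1 r) w := rfl

/-- An orthonormal basis of the orthogonal complement of `p H₊` in `V`. -/
theorem Between.exists_basis {p q : ℂ[X]} {V : Gr} (hB : Between p q V) :
    ∃ (d : ℕ) (e : Fin d → H), (∀ i, e i ∈ V) ∧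
      (∀ i, ∀ k ∈ Hplus, inner ℂ (e i) (mulOp (polyS1 p) k) = 0) ∧ Orthonormal ℂ e ∧
      ∀ w ∈ V, (∀ i, inner ℂ (e i) w = 0) → ∃ k ∈ Hplus, w = mulOp (polyS1 p) k := by
  set K : Submodule ℂ H := Hplus.map (mulOp (polyS1 p)).toLinearMap with hK
  have hmemK : ∀ k ∈ Hplus, mulOp (polyS1 p) k ∈ K := fun k hk => ⟨k, hk, rfl⟩
  have : CompleteSpace K := (isClosed_poly_Hplus hB.inDisc_left).completeSpace_coe
  let E : Submodule ℂ H := V.toSubmodule ⊓ Kᗮ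
  let T : ℂ[X] →ₗ[ℂ] H := (Kᗮ.starProjection.comp
    (mulOp (invC _ hB.inDisc_right.polyS1_ne_zero))).toLinearMap.comp (polyAct (ofC 1))
  -- Finite dimension of the complement: modulo `p H₊` each element of `V` is `r / q` with `deg r <
  -- deg (p * q)`, and `T` projects `r / q` away from `p H₊`.
  have hE : E ≤ (degreeLT ℂ (p * q).natDegree).map T := by
    rintro w ⟨hw, hwK⟩
    obtain ⟨r, e, k, hr, he, hk, hre, rfl⟩ := hB.exists_finiteOrder_add hw
    refine ⟨r, mem_degreeLT.2 (by rwa [← degree_eq_natDegree hB.inDisc_mul.1.ne_zero]), ?_⟩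
    have h1 : mulOp (invC _ hB.inDisc_right.polyS1_ne_zero) (polyAct (ofC 1) r) = e := by
      rw [polyAct_apply, ← ofC_eq_mulOp, ← hre, ← mulOp_mul, mul_comm, mul_invC,
        mulOp_one_apply]
    change Kᗮ.starProjection (mulOp (invC _ hB.inDisc_right.polyS1_ne_zero)
      (polyAct (ofC 1) r)) = _
    rw [h1]
    have h2 := Submodule.starProjection_eq_self_iff.2 hwK
    have h3 : Kᗮ.starProjection (mulOp (polyS1 p) k) = 0 := by
      rw [Submodule.starProjection_apply_eq_zero_iff]
      exact Submodule.le_orthogonal_orthogonal K (hmemK k hk)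
    rwa [map_add, h3, add_zero] at h2
  have : FiniteDimensional ℂ E := Submodule.finiteDimensional_of_le hE
  let b := stdOrthonormalBasis ℂ E
  refine ⟨_, fun i => (b i : H), fun i => (b i).2.1, fun i k hk => ?_, ?_, fun w hw h => ?_⟩
  · exact (Submodule.mem_orthogonal' _ _).1 (b i).2.2 _ (hmemK k hk)
  · exact b.orthonormal.comp_linearIsometry E.subtypeₗᵢ
  · have h1 : K.starProjection w ∈ K := K.starProjection_apply_mem w
    have hKV : K ≤ V.toSubmodule := by
      rintro _ ⟨k, hk, rfl⟩
      exact hB.lower k hk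
    have h2 : w - K.starProjection w ∈ E :=
      ⟨sub_mem hw (hKV h1), Submodule.sub_starProjection_mem_orthogonal w⟩
    have h3 : (⟨_, h2⟩ : E) = 0 := by
      refine b.repr.injective (PiLp.ext fun i => ?_)
      rw [map_zero, PiLp.zero_apply, b.repr_apply_apply, Submodule.coe_inner, inner_sub_right, h i,
        (Submodule.mem_orthogonal' _ _).1 (b i).2.2 _ h1, sub_zero]
    have h4 : w = K.starProjection w := sub_eq_zero.1 (congrArg Subtype.val h3)
    rw [← h4] at h1
    obtain ⟨k, hk, e⟩ := h1
    exact ⟨k, hk, e.symm⟩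

section Families

variable {S : Type*} {x₀ : S} {l : Filter S} {R : Subalgebra ℂ (S → ℂ)}

/-- The member at `x` of a family of polynomials. -/
noncomputable def polyAt (R : Subalgebra ℂ (S → ℂ)) (x : S) : R[X] →+* ℂ[X] :=
  mapRingHom (evalAt R x : R →+* ℂ)

theorem polyAt_eq_sum (U : R[X]) (x : S) :
    polyAt R x U = ∑ i : Fin (U.natDegree + 1), C (evalAt R x (U.coeff i)) * X ^ (i : ℕ) := by
  rw [Fin.sum_univ_eq_sum_range (fun i => C (evalAt R x (U.coeff i)) * X ^ i)]
  conv_lhs => rw [U.as_sum_range_C_mul_X_pow]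
  rw [map_sum]
  refine Finset.sum_congr rfl fun i _ => ?_
  simp [polyAt]

theorem polyAt_C_map (u : ℂ[X]) (x : S) : polyAt R x (u.map (algebraMap ℂ R)) = u := by
  rw [polyAt, coe_mapRingHom, Polynomial.map_map]
  convert Polynomial.map_id
  ext c
  simp

theorem polyAt_C (a : R) (x : S) : polyAt R x (C a) = C (evalAt R x a) := by
  simp [polyAt]

theorem eval_polyAt (U : R[X]) (x : S) (c : ℂ) :
    (polyAt R x U).eval c = evalAt R x (U.eval (algebraMap ℂ R c)) := by
  have h : c = (evalAt R x : R →+* ℂ) (algebraMap ℂ R c) := by simp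
  conv_lhs => rw [h]
  rw [polyAt, coe_mapRingHom, eval_map, eval₂_hom]
  rfl

theorem mulOp_polyAt (U : R[X]) (x : S) (w : H) :
    mulOp (polyS1 (polyAt R x U)) w =
      ∑ i : Fin (U.natDegree + 1), evalAt R x (U.coeff i) • mulOp (polyS1 (X ^ (i : ℕ))) w := by
  rw [polyAt_eq_sum, ← polyAct_apply, map_sum]
  refine Finset.sum_congr rfl fun i _ => ?_
  rw [polyAct_apply, map_mul, mulOp_mul, mulOp_C]

/-- The family of subspaces `v V + p H₊`, where `v` runs through a family of polynomials with
`v = 1` at `x₀`, is given in the chart around `V` by finitely many functions. -/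
theorem Between.exists_graph {p q : ℂ[X]} {V : Gr} (hB : Between p q V)
    (hR : IsLocalAlgebra x₀ l R) (U : R[X]) (hU : polyAt R x₀ U = 1) :
    ∃ (m : ℕ) (B : Fin m → (V.toSubmodule →L[ℂ] (V.toSubmodule)ᗮ)) (a : Fin m → R),
      ∀ᶠ x in l, ∀ V' : Gr,
        (∀ v, v ∈ V' ↔ ∃ w ∈ V, ∃ k ∈ Hplus,
          v = mulOp (polyS1 (polyAt R x U)) w + mulOp (polyS1 p) k) →
        IsGraph V' V (∑ i, evalAt R x (a i) • B i) := by
  obtain ⟨d, e, heV, hep, heo, hker⟩ := hB.exists_basis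
  have hee := orthonormal_iff_ite.1 heo
  -- The matrix of inner products of `e k` with `u e j`; at `x₀`, where `u = 1`, it is the identity.
  -- Given `w` in `V`, put `c = G⁻¹ ⟨e, w⟩` and `y = ∑ c j u e j`. Then `w` and the projection `π y`
  -- to `V` differ by an element of `p H₊`, so `w + (y - π y)` lies in `u V + p H₊`. The graph map
  -- is therefore `w ↦ y - π y`, a combination over `R` of the rank-one operators `B`.
  let G : Matrix (Fin d) (Fin d) R := Matrix.of fun k j => ∑ i : Fin (U.natDegree + 1),
    U.coeff i * algebraMap ℂ R (inner ℂ (e k) (mulOp (polyS1 (X ^ (i : ℕ))) (e j)))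
  have hG : ∀ x k j, G.map (evalAt R x) k j =
      inner ℂ (e k) (mulOp (polyS1 (polyAt R x U)) (e j)) := by
    intro x k j
    rw [mulOp_polyAt, inner_sum]
    simp [G, inner_smul_right]
  have hG0 : G.map (evalAt R x₀) = 1 := by
    ext k j
    rw [hG, hU, map_one, mulOp_one_apply, hee, Matrix.one_apply]
  obtain ⟨N, hN⟩ := hR.exists_matrix_inv G (by rw [hG0, Matrix.det_one]; exact one_ne_zero)
  let ι := Fin (U.natDegree + 1) × Fin d × Fin d
  let B : ι → (V.toSubmodule →L[ℂ] (V.toSubmodule)ᗮ) := fun t =>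
    ((innerSL ℂ (e t.2.2)).comp V.toSubmodule.subtypeL).smulRight
      ((V.toSubmodule)ᗮ.orthogonalProjectionOnto (mulOp (polyS1 (X ^ (t.1 : ℕ))) (e t.2.1)))
  let a : ι → R := fun t => U.coeff t.1 * N t.2.1 t.2.2
  let eq := Fintype.equivFin ι
  refine ⟨Fintype.card ι, B ∘ eq.symm, a ∘ eq.symm, ?_⟩
  filter_upwards [hN] with x hx V' hV'
  have hx' : N.map (evalAt R x) * G.map (evalAt R x) = 1 := mul_eq_one_comm.1 hx
  set u := polyAt R x U
  set π := V.toSubmodule.starProjection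
  -- the value of the graph at a vector with given components
  have hsum : ∀ w : V.toSubmodule,
      (((∑ i, evalAt R x ((a ∘ eq.symm) i) • (B ∘ eq.symm) i) w : (V.toSubmodule)ᗮ) : H) =
        (∑ j, ((N.map (evalAt R x)).mulVec fun k => inner ℂ (e k) (w : H)) j •
            mulOp (polyS1 u) (e j)) -
          π (∑ j, ((N.map (evalAt R x)).mulVec fun k => inner ℂ (e k) (w : H)) j •
            mulOp (polyS1 u) (e j)) := by
    intro w
    have h1 : ∀ y : H, y - π y = (V.toSubmodule)ᗮ.subtype
        ((V.toSubmodule)ᗮ.orthogonalProjectionOnto y) := fun y => by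
      rw [Submodule.subtype_apply, Submodule.coe_orthogonalProjectionOnto_apply,
        Submodule.starProjection_orthogonal']
      rfl
    rw [h1, ← Submodule.subtype_apply]
    congr 1
    have h2 : ∑ i, evalAt R x ((a ∘ eq.symm) i) • (B ∘ eq.symm) i =
        ∑ t, evalAt R x (a t) • B t := Equiv.sum_comp eq.symm fun t => evalAt R x (a t) • B t
    rw [h2, sum_apply,
      map_sum, Fintype.sum_prod_type_right, Fintype.sum_prod_type]
    refine Finset.sum_congr rfl fun j _ => ?_
    rw [map_smul, mulOp_polyAt, map_sum, Matrix.mulVec, dotProduct, Finset.sum_smul]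
    refine Finset.sum_congr rfl fun k _ => ?_
    rw [Finset.smul_sum]
    refine Finset.sum_congr rfl fun i _ => ?_
    simp only [B, a, smul_apply, ContinuousLinearMap.smulRight_apply,
      map_smul, map_mul, Matrix.map_apply, smul_smul]
    congr 1
    simp only [ContinuousLinearMap.comp_apply, innerSL_apply_apply, Submodule.subtypeL_apply]
    ring
  have hπe : ∀ k y, inner ℂ (e k) (π y) = inner ℂ (e k) y := fun k y => by
    rw [← Submodule.inner_starProjection_left_eq_right,
      Submodule.starProjection_eq_self_iff.2 (heV k)]
  have hGc : ∀ (c : Fin d → ℂ) k, inner ℂ (e k) (∑ j, c j • mulOp (polyS1 u) (e j)) =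
      (G.map (evalAt R x)).mulVec c k := by
    intro c k
    rw [inner_sum, Matrix.mulVec, dotProduct]
    refine Finset.sum_congr rfl fun j _ => ?_
    rw [inner_smul_right, hG, mul_comm]
  intro v
  rw [hV']
  constructor
  · rintro ⟨w₁, hw₁, k₁, hk₁, rfl⟩
    set c : Fin d → ℂ := fun j => inner ℂ (e j) w₁
    obtain ⟨k₂, hk₂, e₂⟩ := hker (w₁ - ∑ j, c j • e j)
      (V.toSubmodule.sub_mem hw₁ (V.toSubmodule.sum_mem fun j _ =>
        V.toSubmodule.smul_mem _ (heV j))) fun i => by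
      rw [inner_sub_right, inner_sum]
      simp [inner_smul_right, hee, c]
    set y := ∑ j, c j • mulOp (polyS1 u) (e j) with hy
    obtain ⟨k₃, hk₃, e₃⟩ : ∃ k ∈ Hplus, mulOp (polyS1 u) w₁ + mulOp (polyS1 p) k₁ =
        y + mulOp (polyS1 p) k := by
      refine ⟨mulOp (polyS1 u) k₂ + k₁, add_mem (polyS1_mem_discAlgebra u _ hk₂) hk₁, ?_⟩
      rw [sub_eq_iff_eq_add.1 e₂, map_add (mulOp (polyS1 u)), map_add (mulOp (polyS1 p)),
        mulOp_comm (polyS1 p) (polyS1 u), hy, map_sum]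
      simp only [map_smul]
      abel
    rw [e₃]
    have hpk : mulOp (polyS1 p) k₃ ∈ V.toSubmodule := hB.lower k₃ hk₃
    refine ⟨⟨π y + mulOp (polyS1 p) k₃, add_mem (Submodule.starProjection_apply_mem _ _) hpk⟩,
      ?_⟩
    rw [hsum]
    have h5 : ((N.map (evalAt R x)).mulVec fun k =>
        inner ℂ (e k) (π y + mulOp (polyS1 p) k₃)) = c := by
      have : (fun k => inner ℂ (e k) (π y + mulOp (polyS1 p) k₃)) =
          (G.map (evalAt R x)).mulVec c := by
        ext k
        rw [inner_add_right, hπe, hep k k₃ hk₃, add_zero, hGc]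
      rw [this, Matrix.mulVec_mulVec, hx', Matrix.one_mulVec]
    simp only [h5]
    rw [← hy]
    abel
  · rintro ⟨w, rfl⟩
    rw [hsum]
    set c := (N.map (evalAt R x)).mulVec fun k => inner ℂ (e k) (w : H) with hc
    set y := ∑ j, c j • mulOp (polyS1 u) (e j) with hy
    obtain ⟨k, hk, ek⟩ := hker ((w : H) - π y)
      (V.toSubmodule.sub_mem w.2 (Submodule.starProjection_apply_mem _ _)) fun i => by
      rw [inner_sub_right, hπe, hGc, hc, Matrix.mulVec_mulVec, hx, Matrix.one_mulVec, sub_self]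
    refine ⟨∑ j, c j • e j, V.toSubmodule.sum_mem fun j _ => V.toSubmodule.smul_mem _ (heV j),
      k, hk, ?_⟩
    have h6 : mulOp (polyS1 u) (∑ j, c j • e j) = y := by
      rw [hy, map_sum]
      simp only [map_smul]
    rw [← ek, h6]
    abel

end Families

/-! ### Families of multipliers -/

/-- The polynomials `u` with `u V ⊆ V'`. -/
noncomputable def multipliers (V V' : Gr) : Submodule ℂ ℂ[X] where
  carrier := {u | ∀ w ∈ V, mulOp (polyS1 u) w ∈ V'}
  zero_mem' w _ := by rw [← polyAct_apply, map_zero]; exact zero_mem V'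
  add_mem' hu hv w hw := by
    rw [← polyAct_apply, map_add]; exact add_mem (hu w hw) (hv w hw)
  smul_mem' c u hu w hw := by
    rw [← polyAct_apply, map_smul]; exact V'.smul_mem c (hu w hw)

theorem mem_multipliers {V V' : Gr} {u : ℂ[X]} :
    u ∈ multipliers V V' ↔ ∀ w ∈ V, mulOp (polyS1 u) w ∈ V' := Iff.rfl

instance (N : ℕ) : FiniteDimensional ℂ (degreeLT ℂ N) :=
  (degreeLTEquiv ℂ N).symm.finiteDimensional

/-- Multiplication by a unit `v` modulo `m` is injective on remainders. -/
theorem finrank_comap_le_of_mul_modByMonic {m v : ℂ[X]} (hm : m.Monic) (hv : IsCoprime m v)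
    (K K' : Submodule ℂ ℂ[X]) (h : ∀ u ∈ K, (u * v) %ₘ m ∈ K') :
    Module.finrank ℂ (K.comap (degreeLT ℂ m.natDegree).subtype) ≤
      Module.finrank ℂ (K'.comap (degreeLT ℂ m.natDegree).subtype) := by
  let θ : ℂ[X] →ₗ[ℂ] ℂ[X] := (modByMonicHom m).comp (LinearMap.mulRight ℂ v)
  let f : degreeLT ℂ m.natDegree →ₗ[ℂ] degreeLT ℂ m.natDegree :=
    (θ.comp (degreeLT ℂ m.natDegree).subtype).codRestrict _ fun u => by
      rw [mem_degreeLT, ← degree_eq_natDegree hm.ne_zero]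
      exact degree_modByMonic_lt _ hm
  have hf : Function.Injective f := by
    rw [injective_iff_map_eq_zero]
    intro u hu
    have h1 : (u.1 * v) %ₘ m = 0 := congrArg Subtype.val hu
    rw [modByMonic_eq_zero_iff_dvd hm] at h1
    refine Subtype.ext (eq_zero_of_dvd_of_degree_lt (hv.dvd_of_dvd_mul_right h1) ?_)
    rw [degree_eq_natDegree hm.ne_zero]
    exact mem_degreeLT.1 u.2
  rw [(Submodule.equivMapOfInjective f hf _).finrank_eq]
  refine Submodule.finrank_mono ?_
  rintro _ ⟨u, hu, rfl⟩
  exact h u.1 hu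

/-- Applied to `w` in `V`, the remainder of `u v` agrees with `g u` up to `p H₊`, which is contained
in `g V`. -/
theorem Between.mul_modByMonic_mem_multipliers {p q : ℂ[X]} {V : Gr} (hB : Between p q V)
    {g : C(S1, ℂ)ˣ} (hg : g ∈ GammaPlus) {v : ℂ[X]}
    (hv : IsResidue (p * q) (g : C(S1, ℂ)) v) (u : ℂ[X]) (hu : u ∈ multipliers V V) :
    (u * v) %ₘ (p * q) ∈ multipliers V (g • V) := by
  intro w hw
  have hBg := hB.smul hg
  have h1 : (u * v) %ₘ (p * q) = v * u - p * q * ((u * v) /ₘ (p * q)) := by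
    rw [mul_comm v]; exact eq_sub_of_add_eq (modByMonic_add_div _ _)
  obtain ⟨k, hk, e⟩ := hB.residue_mul hv (hu w hw)
  obtain ⟨k', hk', e'⟩ := hB.conductor_mul
    (polyS1_mem_discAlgebra ((u * v) /ₘ (p * q))) hw
  rw [h1, map_sub polyS1, mulOp_sub_apply, map_mul polyS1 (p * q), e', map_mul polyS1 v,
    mulOp_mul, eq_sub_of_add_eq e.symm]
  exact (g • V).toSubmodule.sub_mem ((g • V).toSubmodule.sub_mem (mulOp_mem_smul g (hu w hw))
    (hBg.lower k hk)) (hBg.lower k' hk')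

/-- The dimension of the spaces of multipliers from `V` to the points of its orbit is at least
that of the space of multipliers of `V`. -/
theorem Between.finrank_multipliers_le {p q : ℂ[X]} {V : Gr} (hB : Between p q V)
    {g : C(S1, ℂ)ˣ} (hg : g ∈ GammaPlus) :
    Module.finrank ℂ ((multipliers V V).comap (degreeLT ℂ (p * q).natDegree).subtype) ≤
      Module.finrank ℂ ((multipliers V (g • V)).comap
        (degreeLT ℂ (p * q).natDegree).subtype) := by
  have hm := hB.inDisc_mul
  obtain ⟨v, -, hv⟩ := exists_isResidue hm (GammaPlus.mem_discAlgebra hg)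
  exact finrank_comap_le_of_mul_modByMonic hm.1
    (isCoprime_of_eval_ne_zero fun c hc => hv.eval_ne_zero hm hg hc).symm _ _
    (hB.mul_modByMonic_mem_multipliers hg hv)

section Families

variable {S : Type*} {x₀ : S} {l : Filter S} {R : Subalgebra ℂ (S → ℂ)}

/-- If `V'` is the graph of `B`, then `u V ⊆ V'` forces `⟨y, u w⟩ = ⟨y, B (π (u w))⟩` for `w` in `V`
and `y` in `Vᗮ`, where `π` projects onto `V`. These equations are linear in `u` with coefficients in
`R`. At `x₀` their solutions are the multipliers of `V`, among them 1, and
`Between.finrank_multipliers_le` excludes a drop in dimension nearby. -/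
theorem Between.exists_multiplier {p q : ℂ[X]} {V : Gr} (hB : Between p q V)
    (hpos : 0 < (p * q).natDegree) (hR : IsLocalAlgebra x₀ l R)
    (B : S → (V.toSubmodule →L[ℂ] (V.toSubmodule)ᗮ))
    (hBR : ∀ y w, (fun x => inner ℂ y (B x w)) ∈ R) (hB0 : B x₀ = 0) :
    ∃ U : R[X], polyAt R x₀ U = 1 ∧ ∀ᶠ x in l, ∀ g ∈ GammaPlus, IsGraph (g • V) V (B x) →
      ∀ w ∈ V, mulOp (polyS1 (polyAt R x U)) w ∈ g • V := by
  set P := degreeLT ℂ (p * q).natDegree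
  let φ : (V.toSubmodule × (V.toSubmodule)ᗮ) → S → P →ₗ[ℂ] ℂ := fun i x =>
    (innerSL ℂ (i.2 : H) - (innerSL ℂ i.2).comp ((B x).comp
      V.toSubmodule.orthogonalProjectionOnto)).toLinearMap.comp ((polyAct (i.1 : H)).comp P.subtype)
  have hφ : ∀ i x u, φ i x u = inner ℂ (i.2 : H) (mulOp (polyS1 (u : ℂ[X])) i.1) -
      inner ℂ i.2 (B x (V.toSubmodule.orthogonalProjectionOnto
        (mulOp (polyS1 (u : ℂ[X])) i.1))) := fun i x u => rfl
  have h1P : (1 : ℂ[X]) ∈ P := by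
    rw [mem_degreeLT, degree_one]
    exact_mod_cast hpos
  obtain ⟨r, e, a, ha, hsol⟩ := hR.exists_solution φ (fun i u => by
      simp only [hφ]
      exact sub_mem (R.algebraMap_mem (inner ℂ (i.2 : H) (mulOp (polyS1 (u : ℂ[X])) i.1)))
        (hBR _ _)) ((multipliers V V).comap P.subtype) (fun u => by
      simp only [hφ, hB0, zero_apply, inner_zero_right, sub_zero]
      rw [Submodule.mem_comap, Submodule.subtype_apply, mem_multipliers]
      constructor
      · intro h w hw
        exact mem_of_forall_orthogonal V _ fun x hx => h (⟨w, hw⟩,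
          ⟨x, (Submodule.mem_orthogonal _ _).2 hx⟩)
      · intro h i
        exact (Submodule.mem_orthogonal' _ _).1 i.2.2 _ (h i.1 i.1.2))
    ⟨1, h1P⟩ (fun w hw => by
      rw [Submodule.subtype_apply, map_one, mulOp_one_apply]; exact hw)
  refine ⟨1 + ∑ j, C (a j) * ((e j : ℂ[X]).map (algebraMap ℂ R)), ?_, ?_⟩
  · rw [map_add, map_one, map_sum]
    simp [polyAt_C, ha]
  · filter_upwards [hsol] with x hx g hg hgraph w hw
    have h1 := hx ((multipliers V (g • V)).comap P.subtype) (fun u hu i => ?_)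
      (hB.finrank_multipliers_le hg)
    · have h2 := h1 w hw
      convert h2 using 4
      rw [map_add, map_one, map_sum]
      simp [polyAt_C, polyAt_C_map, smul_eq_C_mul]
    · rw [hφ]
      obtain ⟨w', hw'⟩ := (hgraph _).1 (hu i.1 i.1.2)
      change mulOp (polyS1 (u : ℂ[X])) i.1 = _ at hw'
      have h3 : V.toSubmodule.orthogonalProjectionOnto ((w' : H) + (B x w' : H)) = w' := by
        rw [map_add, Submodule.orthogonalProjectionOnto_mem_subspace_eq_self,
          Submodule.orthogonalProjectionOnto_apply_of_mem_orthogonal (B x w').2, add_zero]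
      rw [hw', h3, inner_add_right, (Submodule.mem_orthogonal' _ _).1 i.2.2 _ w'.2, zero_add,
        Submodule.coe_inner, sub_self]

end Families

/-! ### Comparison of families in the orbit and in the Jacobian -/

theorem GammaPlus.smul_comm (g h : GammaPlus) (V : Gr) : (h * g) • V = g • (h • V) := by
  have e : h * g = g * h := Subtype.ext (mul_comm (h : C(S1, ℂ)ˣ) g)
  rw [e, mul_smul]

section Comparison

variable {W : Gr} {p q : ℂ[X]} {ψ : GammaPlus → GenJacobian (spectralRing W)}

theorem IsJacobianMap.class_one (hψ : IsJacobianMap W (p * q) ψ) : ψ 1 = 0 := by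
  have := hψ.class_mul 1 1
  rwa [mul_one, left_eq_add] at this

theorem IsJacobianMap.class_inv (hψ : IsJacobianMap W (p * q) ψ) (g : GammaPlus) :
    ψ g⁻¹ = -ψ g := by
  rw [eq_neg_iff_add_eq_zero, ← hψ.class_mul, inv_mul_cancel, hψ.class_one]

/-- Some `g'` in `Γ₊` has residue `a v` with `a` a non-zero constant, hence the same class as `h`;
so `h` may be replaced by `g'`, which acts like `a v` modulo `p H₊`. -/
theorem IsJacobianMap.mem_smul_iff_of_class (hψ : IsJacobianMap W (p * q) ψ)
    (hB : Between p q W) {g h : GammaPlus} {v : ℂ[X]}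
    (hv : ∀ c, (p * q).eval c = 0 → v.eval c ≠ 0)
    (hvh : IsZeroClass (spectralRing W) v (ψ h)) (y : H) :
    y ∈ (h * g) • W ↔ ∃ w ∈ g • W, ∃ k ∈ Hplus, y = mulOp (polyS1 v) w + mulOp (polyS1 p) k := by
  obtain ⟨g', hg', a, ha, f, hf, e⟩ := exists_GammaPlus_eq hB.inDisc_mul v hv
  have hres : IsResidue (p * q) (g' : C(S1, ℂ)) (C a * v) := ⟨f, hf, e⟩
  have h1 : ψ ⟨g', hg'⟩ = ψ h := (hψ.class_of_residue ⟨g', hg'⟩ _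
    (mul_ne_zero (C_ne_zero.2 ha) hvh.1) hres).unique (hvh.C_mul ha)
  have h2 : (h * g) • W = g' • (g • W) := by
    rw [GammaPlus.smul_comm, ← (hψ.eq_iff _ _).1 h1, ← mul_smul, GammaPlus.smul_comm]
    rfl
  have hBg : Between p q (g • W) := hB.smul g.2
  have hBg' := hBg.smul hg'
  rw [h2, mem_smul_iff]
  constructor
  · rintro ⟨w, hw, rfl⟩
    obtain ⟨k, hk, e⟩ := hBg.residue_mul hres hw
    exact ⟨a • w, (g • W).smul_mem a hw, k, hk, by
      rw [e, map_mul, mulOp_mul, mulOp_C, map_smul]⟩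
  · rintro ⟨w, hw, k, hk, rfl⟩
    have hw' : a⁻¹ • w ∈ g • W := (g • W).smul_mem _ hw
    obtain ⟨k', hk', e⟩ := hBg.residue_mul hres hw'
    rw [← mem_smul_iff]
    have e' : mulOp (polyS1 v) w = mulOp (g' : C(S1, ℂ)) (a⁻¹ • w) - mulOp (polyS1 p) k' := by
      rw [e, add_sub_cancel_right, map_mul, mulOp_mul, mulOp_C, ← map_smul, smul_smul,
        mul_inv_cancel₀ ha, one_smul]
    rw [e']
    exact add_mem ((g' • (g • W)).toSubmodule.sub_mem (mulOp_mem_smul g' hw')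
      (hBg'.lower k' hk')) (hBg'.lower k hk)

/-- Cancelling the commuting factor `g` gives `u W ⊆ h W`. If `v` is a residue of `h⁻¹`, then `v u`
maps `W` to itself, so it lies in `A` and has class zero. -/
theorem IsJacobianMap.class_of_multiplier (hψ : IsJacobianMap W (p * q) ψ)
    (hB : Between p q W) {g h : GammaPlus} {u : ℂ[X]} (hu : u ≠ 0)
    (hu' : ∀ c, (p * q).eval c = 0 → u.eval c ≠ 0)
    (hmul : ∀ w ∈ g • W, mulOp (polyS1 u) w ∈ (h * g) • W) :
    IsZeroClass (spectralRing W) u (ψ h) := by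
  obtain ⟨m₀, hA, hdvd⟩ := hB.exists_isConductor
  have hm := hB.inDisc_mul
  have hroot : ∀ {c}, c ∈ singularSet (spectralRing W) → (p * q).eval c = 0 := fun hc =>
    eval_eq_zero_of_dvd_of_eval_eq_zero hdvd ((hA.mem_singularSet _).1 hc)
  obtain ⟨v, hv, hres⟩ := exists_isResidue hm (GammaPlus.mem_discAlgebra (h⁻¹).2)
  have hvc := hψ.class_of_residue h⁻¹ v hv hres
  obtain ⟨x, hx⟩ := exists_isZeroClass (A := spectralRing W) hu fun c hc => hu' c (hroot hc)
  have hmem : v * u ∈ spectralRing W := by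
    rw [hB.mem_spectralRing]
    intro w hw
    have h1 := hmul _ (mulOp_mem_smul (g : C(S1, ℂ)ˣ) hw)
    rw [GammaPlus.smul_comm] at h1
    obtain ⟨y, hy, e1⟩ := (mem_smul_iff (g : C(S1, ℂ)ˣ) (h • W) _).1 h1
    obtain ⟨z, hz, e2⟩ := (mem_smul_iff (h : C(S1, ℂ)ˣ) W _).1 hy
    have e3 : mulOp (polyS1 u) w = y := by
      rw [mulOp_comm] at e1
      have := congrArg (mulOp ((((g : C(S1, ℂ)ˣ)⁻¹ : C(S1, ℂ)ˣ)) : C(S1, ℂ))) e1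
      rwa [← mulOp_mul _ _ y, ← mulOp_mul _ _ (mulOp (polyS1 u) w), Units.inv_mul,
        mulOp_one_apply, mulOp_one_apply] at this
    have e4 : mulOp (((h⁻¹ : GammaPlus) : C(S1, ℂ)ˣ) : C(S1, ℂ)) (mulOp (polyS1 u) w) = z := by
      rw [e3, e2, ← mulOp_mul]
      change mulOp ((((h : C(S1, ℂ)ˣ)⁻¹ : C(S1, ℂ)ˣ) : C(S1, ℂ)) * _) z = z
      rw [Units.inv_mul, mulOp_one_apply]
    obtain ⟨k, hk, e5⟩ := hB.residue_mul hres hw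
    rw [map_mul, mul_comm, mulOp_mul, eq_sub_of_add_eq e5.symm, map_sub (mulOp _), mulOp_comm,
      e4, mulOp_comm]
    exact W.toSubmodule.sub_mem hz (hB.lower _ (polyS1_mem_discAlgebra u k hk))
  have h2 := (hvc.mul hx).unique (IsSingUnit.isZeroClass_zero ⟨hmem, mul_ne_zero hv hu,
    fun c hc => by
      rw [eval_mul]
      exact mul_ne_zero (hvc.eval_ne_zero c hc) (hu' c (hroot hc))⟩)
  rw [hψ.class_inv, neg_add_eq_zero] at h2
  rwa [h2]

variable {S : Type*} {l : Filter S} {R : Subalgebra ℂ (S → ℂ)} {T : Set S} {t₀ : T}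

theorem eventually_eval_polyAt_ne_zero (hR : IsLocalAlgebra t₀.1 l R) {U : R[X]}
    (hU : polyAt R t₀.1 U = 1) {m : ℂ[X]} (hm : m ≠ 0) :
    ∀ᶠ x in l, polyAt R x U ≠ 0 ∧ ∀ c, m.eval c = 0 → (polyAt R x U).eval c ≠ 0 := by
  have key : ∀ c, ∀ᶠ x in l, (polyAt R x U).eval c ≠ 0 := fun c => by
    simp_rw [eval_polyAt]
    refine hR.eventually_ne_zero _ ?_
    rw [← eval_polyAt, hU, eval_one]
    exact one_ne_zero
  have h1 := (Filter.eventually_all_finset m.roots.toFinset).2 fun c _ => key c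
  -- The value at the point 0 guarantees a non-zero polynomial independently of the roots of `m`.
  filter_upwards [key 0, h1] with x h0 hx
  exact ⟨fun h => h0 (by rw [h, eval_zero]), fun c hc => hx c (by simp [hm, hc])⟩

theorem IsJacobianMap.exists_graph (hψ : IsJacobianMap W (p * q) ψ) (hB : Between p q W)
    (hR : IsLocalAlgebra t₀.1 l R) (g : T → GammaPlus) (U : R[X])
    (hU : ∀ᶠ x in l, ∀ hx : x ∈ T,
      IsZeroClass (spectralRing W) (polyAt R x U) (ψ (g ⟨x, hx⟩))) :
    ∃ (m : ℕ) (B : Fin m → ((g t₀ • W).toSubmodule →L[ℂ] ((g t₀ • W).toSubmodule)ᗮ))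
      (a : Fin m → R), ∀ᶠ x in l, ∀ hx : x ∈ T,
        IsGraph (g ⟨x, hx⟩ • W) (g t₀ • W) (∑ i, evalAt R x (a i) • B i) := by
  obtain ⟨m₀, hA, hdvd⟩ := hB.exists_isConductor
  have hm := hB.inDisc_mul.1.ne_zero
  have hU0 := hR.pure_le hU t₀.2
  obtain ⟨b, ⟨k, hk⟩, hb⟩ := hA.exists_inverse_class hU0
  -- Multiplying by an inverse of `U` at `t₀` modulo `m₀`, then subtracting a multiple of `m₀`,
  -- gives a family equal to 1 at `t₀` whose class is that of `g x * (g t₀)⁻¹`.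
  set U' : R[X] := U * b.map (algebraMap ℂ R) + (-(m₀ * k)).map (algebraMap ℂ R)
  have hU' : ∀ x, polyAt R x U' = polyAt R x U * b - m₀ * k := fun x => by
    rw [map_add, map_mul, polyAt_C_map, polyAt_C_map, ← sub_eq_add_neg]
  have hU'0 : polyAt R t₀.1 U' = 1 := by rw [hU', ← hk]; ring
  have hBg : Between p q (g t₀ • W) := hB.smul (g t₀).2
  obtain ⟨n, B, a, hgr⟩ := hBg.exists_graph hR U' hU'0
  refine ⟨n, B, a, ?_⟩
  filter_upwards [hgr, hU, eventually_eval_polyAt_ne_zero hR hU'0 hm] with x h1 h2 h3 hx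
  have h4 : IsZeroClass (spectralRing W) (polyAt R x U') (ψ (g ⟨x, hx⟩ * (g t₀)⁻¹)) := by
    rw [hψ.class_mul, hψ.class_inv]
    refine hA.isZeroClass_congr ((h2 hx).mul hb) h3.1 ?_
    rw [hU', sub_sub_cancel_left]
    exact (dvd_mul_right m₀ k).neg_right
  refine h1 _ fun v => ?_
  have h5 := hψ.mem_smul_iff_of_class hB (g := g t₀) h3.2 h4 v
  rwa [inv_mul_cancel_right] at h5

theorem IsJacobianMap.exists_zeroClass (hψ : IsJacobianMap W (p * q) ψ) (hB : Between p q W)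
    (hpos : 0 < (p * q).natDegree) (hR : IsLocalAlgebra t₀.1 l R) (g : T → GammaPlus)
    (B : S → ((g t₀ • W).toSubmodule →L[ℂ] ((g t₀ • W).toSubmodule)ᗮ))
    (hBR : ∀ y w, (fun x => inner ℂ y (B x w)) ∈ R)
    (hgr : ∀ᶠ x in l, ∀ hx : x ∈ T, IsGraph (g ⟨x, hx⟩ • W) (g t₀ • W) (B x)) :
    ∃ U : R[X], ∀ᶠ x in l, ∀ hx : x ∈ T,
      IsZeroClass (spectralRing W) (polyAt R x U) (ψ (g ⟨x, hx⟩)) := by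
  obtain ⟨m₀, hA, hdvd⟩ := hB.exists_isConductor
  have hm := hB.inDisc_mul.1.ne_zero
  -- The member at `t₀` is the base point of the chart, and `V` meets `Vᗮ` only in zero.
  have hB0 : B t₀.1 = 0 := by
    have h1 := hR.pure_le hgr t₀.2
    refine ContinuousLinearMap.ext fun w => ?_
    have h2 : (w : H) + B t₀.1 w ∈ (g t₀ • W).toSubmodule := (h1 _).2 ⟨w, rfl⟩
    have h3 : (B t₀.1 w : H) ∈ (g t₀ • W).toSubmodule := by
      have := (g t₀ • W).toSubmodule.sub_mem h2 w.2
      rwa [add_sub_cancel_left] at this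
    have h4 := (g t₀ • W).toSubmodule.orthogonal_disjoint.le_bot ⟨h3, (B t₀.1 w).2⟩
    simpa using h4
  have hBg : Between p q (g t₀ • W) := hB.smul (g t₀).2
  obtain ⟨U, hU0, hU⟩ := hBg.exists_multiplier hpos hR B hBR hB0
  obtain ⟨u₀, hu₀⟩ := hA.exists_isZeroClass (ψ (g t₀))
  -- `U` represents the class of `g x * (g t₀)⁻¹`; the constant factor `u₀` restores that of `g t₀`.
  refine ⟨U * u₀.map (algebraMap ℂ R), ?_⟩
  filter_upwards [hgr, hU, eventually_eval_polyAt_ne_zero hR hU0 hm] with x h1 h2 h3 hx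
  have e : (g ⟨x, hx⟩ * (g t₀)⁻¹) • (g t₀ • W) = g ⟨x, hx⟩ • W := by
    rw [← mul_smul, inv_mul_cancel_right]
  have h4 := h2 _ (g ⟨x, hx⟩ * (g t₀)⁻¹).2
  change IsGraph ((g ⟨x, hx⟩ * (g t₀)⁻¹) • (g t₀ • W)) _ _ →
    ∀ w ∈ g t₀ • W, _ ∈ (g ⟨x, hx⟩ * (g t₀)⁻¹) • (g t₀ • W) at h4
  rw [e] at h4
  have h5 := hψ.class_of_multiplier hB (g := g t₀) (h := g ⟨x, hx⟩ * (g t₀)⁻¹) h3.1 h3.2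
    (by rw [inv_mul_cancel_right]; exact h4 (h1 hx))
  have h6 := h5.mul hu₀
  rw [map_mul, polyAt_C_map]
  rwa [← hψ.class_mul, inv_mul_cancel_right] at h6

end Comparison

/-! ### Rational functions and analytic functions -/

section LocalAlgebras

variable {n : ℕ}

/-- The functions which are rational in a Zariski neighbourhood of `t₀`. -/
noncomputable def rationalAt (t₀ : Fin n → ℂ) : Subalgebra ℂ ((Fin n → ℂ) → ℂ) where
  carrier := {f | ∃ P Q : MvPolynomial (Fin n) ℂ, MvPolynomial.eval t₀ Q ≠ 0 ∧
    ∀ t, MvPolynomial.eval t Q ≠ 0 → f t = MvPolynomial.eval t P / MvPolynomial.eval t Q}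
  mul_mem' := by
    rintro f g ⟨P, Q, hQ, h⟩ ⟨P', Q', hQ', h'⟩
    refine ⟨P * P', Q * Q', by rw [map_mul]; exact mul_ne_zero hQ hQ', fun t ht => ?_⟩
    rw [map_mul, mul_ne_zero_iff] at ht
    rw [Pi.mul_apply, h t ht.1, h' t ht.2, map_mul, map_mul, div_mul_div_comm]
  add_mem' := by
    rintro f g ⟨P, Q, hQ, h⟩ ⟨P', Q', hQ', h'⟩
    refine ⟨P * Q' + Q * P', Q * Q', by rw [map_mul]; exact mul_ne_zero hQ hQ', fun t ht => ?_⟩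
    rw [map_mul, mul_ne_zero_iff] at ht
    rw [Pi.add_apply, h t ht.1, h' t ht.2, div_add_div _ _ ht.1 ht.2]
    simp
  algebraMap_mem' c := ⟨MvPolynomial.C c, 1, by simp, fun t _ => by simp⟩

/-- The filter of Zariski neighbourhoods. -/
def zariskiNhds (t₀ : Fin n → ℂ) : Filter (Fin n → ℂ) where
  sets := {s | ∃ Q : MvPolynomial (Fin n) ℂ, MvPolynomial.eval t₀ Q ≠ 0 ∧
    ∀ t, MvPolynomial.eval t Q ≠ 0 → t ∈ s}
  univ_sets := ⟨1, by simp, fun _ _ => trivial⟩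
  sets_of_superset := by
    rintro s s' ⟨Q, hQ, h⟩ hs
    exact ⟨Q, hQ, fun t ht => hs (h t ht)⟩
  inter_sets := by
    rintro s s' ⟨Q, hQ, h⟩ ⟨Q', hQ', h'⟩
    refine ⟨Q * Q', by rw [map_mul]; exact mul_ne_zero hQ hQ', fun t ht => ?_⟩
    rw [map_mul, mul_ne_zero_iff] at ht
    exact ⟨h t ht.1, h' t ht.2⟩

theorem isLocalAlgebra_rationalAt (t₀ : Fin n → ℂ) :
    IsLocalAlgebra t₀ (zariskiNhds t₀) (rationalAt t₀) where
  pure_le := by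
    rintro s ⟨Q, hQ, h⟩
    exact h t₀ hQ
  exists_inv := by
    rintro ⟨f, P, Q, hQ, h⟩ h0
    change f t₀ ≠ 0 at h0
    have hP : MvPolynomial.eval t₀ P ≠ 0 := fun h1 => h0 (by rw [h t₀ hQ, h1, zero_div])
    refine ⟨⟨fun t => MvPolynomial.eval t Q / MvPolynomial.eval t P, Q, P, hP, fun _ _ => rfl⟩,
      Q * P, by rw [map_mul]; exact mul_ne_zero hQ hP, fun t ht => ?_⟩
    rw [map_mul, mul_ne_zero_iff] at ht
    change f t * (MvPolynomial.eval t Q / MvPolynomial.eval t P) = 1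
    have h1 := ht.1
    have h2 := ht.2
    rw [h t ht.1]
    field_simp

/-- Finitely many rational functions have a common denominator, which may be chosen to vanish
outside a given Zariski neighbourhood. -/
theorem exists_common_denominator {t₀ : Fin n → ℂ} {m : ℕ} (a : Fin m → rationalAt t₀)
    {s : Set (Fin n → ℂ)} (hs : s ∈ zariskiNhds t₀) :
    ∃ (P : Fin m → MvPolynomial (Fin n) ℂ) (Q : MvPolynomial (Fin n) ℂ),
      MvPolynomial.eval t₀ Q ≠ 0 ∧ ∀ t, MvPolynomial.eval t Q ≠ 0 → t ∈ s ∧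
        ∀ i, evalAt _ t (a i) = MvPolynomial.eval t (P i) / MvPolynomial.eval t Q := by
  obtain ⟨Q₀, hQ₀, hs⟩ := hs
  choose P Q hQ h using fun i => (a i).2
  refine ⟨fun i => P i * (∏ j ∈ Finset.univ.erase i, Q j) * Q₀, (∏ j, Q j) * Q₀, ?_,
    fun t ht => ?_⟩
  · rw [map_mul, map_prod]
    exact mul_ne_zero (Finset.prod_ne_zero_iff.2 fun i _ => hQ i) hQ₀
  · rw [map_mul, mul_ne_zero_iff, map_prod, Finset.prod_ne_zero_iff] at ht
    refine ⟨hs t ht.2, fun i => ?_⟩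
    rw [evalAt_apply, h i t (ht.1 i (Finset.mem_univ i)), map_mul, map_mul, map_mul,
      mul_div_mul_right _ _ ht.2, ← Finset.mul_prod_erase _ _ (Finset.mem_univ i), map_mul,
      mul_div_mul_right]
    rw [map_prod]
    exact Finset.prod_ne_zero_iff.2 fun j _ => ht.1 j (Finset.mem_univ j)

/-- The functions which are analytic at `t₀`. -/
noncomputable def analyticAlgebra (t₀ : Fin n → ℂ) : Subalgebra ℂ ((Fin n → ℂ) → ℂ) where
  carrier := {f | AnalyticAt ℂ f t₀}
  mul_mem' hf hg := hf.mul hg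
  add_mem' hf hg := hf.add hg
  algebraMap_mem' _ := analyticAt_const

theorem analyticAt_sum_smul {X E F : Type*} [NormedAddCommGroup X] [NormedSpace ℂ X]
    [NormedAddCommGroup E] [NormedSpace ℂ E] [NormedAddCommGroup F] [NormedSpace ℂ F] {m : ℕ}
    {a : Fin m → X → ℂ} {x : X} (ha : ∀ i, AnalyticAt ℂ (a i) x) (B : Fin m → (E →L[ℂ] F)) :
    AnalyticAt ℂ (fun t => ∑ i, a i t • B i) x :=
  Finset.analyticAt_fun_sum _ fun i _ => (ha i).smul analyticAt_const

theorem isLocalAlgebra_analyticAlgebra (t₀ : Fin n → ℂ) :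
    IsLocalAlgebra t₀ (𝓝 t₀) (analyticAlgebra t₀) where
  pure_le := pure_le_nhds t₀
  exists_inv := by
    rintro ⟨f, hf⟩ h0
    have hf' : AnalyticAt ℂ f t₀ := hf
    refine ⟨⟨f⁻¹, hf'.inv h0⟩, ?_⟩
    filter_upwards [hf'.continuousAt.eventually_ne h0] with t ht
    exact mul_inv_cancel₀ ht

end LocalAlgebras

/-! ### Regular and holomorphic families on the orbit and on the Jacobian -/

section Main

variable {W : Gr} {p q : ℂ[X]} {ψ : GammaPlus → GenJacobian (spectralRing W)}

theorem polyAt_sum {S : Type*} {R : Subalgebra ℂ (S → ℂ)} {N : ℕ} (a : Fin N → R) (x : S) :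
    polyAt R x (∑ i, C (a i) * X ^ (i : ℕ)) = ∑ i, C (evalAt R x (a i)) * X ^ (i : ℕ) := by
  simp [polyAt]

theorem IsJacobianMap.isRegular_iff (hψ : IsJacobianMap W (p * q) ψ) (hB : Between p q W)
    (hpos : 0 < (p * q).natDegree) {n : ℕ} {T : Set (Fin n → ℂ)} (g : T → GammaPlus) :
    IsRegularGr (fun t => g t • W) ↔ IsRegularJac (fun t => ψ (g t)) := by
  constructor
  · intro h t₀
    obtain ⟨m, B, P, Q, hQ, hgr⟩ := h t₀
    have hR := isLocalAlgebra_rationalAt t₀.1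
    obtain ⟨U, hU⟩ := hψ.exists_zeroClass hB hpos hR g
      (fun t => ∑ i, (MvPolynomial.eval t (P i) / MvPolynomial.eval t Q) • B i)
      (fun y w => by
        simp only [sum_apply, smul_apply, inner_sum, inner_smul_right]
        have : (fun t => ∑ i, MvPolynomial.eval t (P i) / MvPolynomial.eval t Q *
            inner ℂ y (B i w)) = ∑ i, (fun t => MvPolynomial.eval t (P i) /
              MvPolynomial.eval t Q) * algebraMap ℂ _ (inner ℂ y (B i w)) := by
          ext t; simp
        rw [this]
        exact sum_mem fun i _ => mul_mem ⟨P i, Q, hQ, fun _ _ => rfl⟩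
          (Subalgebra.algebraMap_mem _ _))
      ⟨Q, hQ, fun t ht hx => hgr ⟨t, hx⟩ ht⟩
    obtain ⟨P', Q', hQ', h'⟩ := exists_common_denominator
      (fun i : Fin (U.natDegree + 1) => U.coeff i) hU
    refine ⟨U.natDegree, P', Q', hQ', fun t ht => ?_⟩
    obtain ⟨h1, h2⟩ := h' t.1 ht
    have h3 := h1 t.2
    rw [polyAt_eq_sum] at h3
    simp only [h2] at h3
    exact h3
  · intro h t₀
    obtain ⟨N, P, Q, hQ, hcl⟩ := h t₀
    have hR := isLocalAlgebra_rationalAt t₀.1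
    let a : Fin (N + 1) → rationalAt t₀.1 := fun i =>
      ⟨fun t => MvPolynomial.eval t (P i) / MvPolynomial.eval t Q, P i, Q, hQ, fun _ _ => rfl⟩
    obtain ⟨m, B, b, hb⟩ := hψ.exists_graph hB hR g (∑ i, C (a i) * X ^ (i : ℕ))
      ⟨Q, hQ, fun t ht hx => by rw [polyAt_sum]; exact hcl ⟨t, hx⟩ ht⟩
    obtain ⟨P', Q', hQ', h'⟩ := exists_common_denominator b hb
    refine ⟨m, B, P', Q', hQ', fun t ht => ?_⟩
    obtain ⟨h1, h2⟩ := h' t.1 ht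
    have h3 := h1 t.2
    simp only [h2] at h3
    exact h3

theorem IsJacobianMap.isHolomorphic_iff (hψ : IsJacobianMap W (p * q) ψ) (hB : Between p q W)
    (hpos : 0 < (p * q).natDegree) {n : ℕ} {T : Set (Fin n → ℂ)} (g : T → GammaPlus) :
    IsHolomorphicGr (fun t => g t • W) ↔ IsHolomorphicJac (fun t => ψ (g t)) := by
  constructor
  · intro h t₀
    obtain ⟨B, hBa, hgr⟩ := h t₀
    obtain ⟨U, hU⟩ := hψ.exists_zeroClass hB hpos (isLocalAlgebra_analyticAlgebra t₀.1) g B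
      (fun y w => by
        have := (((innerSL ℂ y).comp (ContinuousLinearMap.apply ℂ _ w)).analyticAt
          (B t₀.1)).comp hBa
        exact this)
      hgr
    refine ⟨U.natDegree, fun i => (U.coeff i).1, fun i => (U.coeff i).2, ?_⟩
    filter_upwards [hU] with t h1 ht
    have h2 := h1 ht
    rwa [polyAt_eq_sum] at h2
  · intro h t₀
    obtain ⟨N, a, ha, hcl⟩ := h t₀
    let a' : Fin (N + 1) → analyticAlgebra t₀.1 := fun i => ⟨a i, ha i⟩
    obtain ⟨m, B, b, hb⟩ := hψ.exists_graph hB (isLocalAlgebra_analyticAlgebra t₀.1) g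
      (∑ i, C (a' i) * X ^ (i : ℕ)) (by
        filter_upwards [hcl] with t h1 ht
        rw [polyAt_sum]
        exact h1 ht)
    refine ⟨fun t => ∑ i, (b i).1 t • B i, ?_, hb⟩
    exact analyticAt_sum_smul (fun i => (b i).2) B

end Main

end KPOrbit

theorem mainTheorem6 (W : KPOrbit.Gr) (hW : KPOrbit.InGr1 W) :
    (∀ g ∈ KPOrbit.GammaMinus, g ≠ 1 → g • W ∉ MulAction.orbit KPOrbit.GammaPlus W) ∧
    KPOrbit.multiplierRing W = (KPOrbit.spectralRing W).map KPOrbit.polyS1 ∧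
    ∃ Φ : MulAction.orbit KPOrbit.GammaPlus W ≃
        KPOrbit.GenJacobian (KPOrbit.spectralRing W),
      (∀ g h : KPOrbit.GammaPlus,
        Φ ⟨(g * h) • W, MulAction.mem_orbit W (g * h)⟩ =
          Φ ⟨g • W, MulAction.mem_orbit W g⟩ + Φ ⟨h • W, MulAction.mem_orbit W h⟩) ∧
      (∀ (n : ℕ) (T : Set (Fin n → ℂ)) (F : T → MulAction.orbit KPOrbit.GammaPlus W),
        KPOrbit.IsRegularGr (fun t => (F t : KPOrbit.Gr)) ↔
          KPOrbit.IsRegularJac (fun t => Φ (F t))) ∧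
      (∀ (n : ℕ) (T : Set (Fin n → ℂ)) (F : T → MulAction.orbit KPOrbit.GammaPlus W),
        IsOpen T →
          (KPOrbit.IsHolomorphicGr (fun t => (F t : KPOrbit.Gr)) ↔
            KPOrbit.IsHolomorphicJac (fun t => Φ (F t)))) := by
  obtain ⟨p, q, hB, hpos⟩ := hW.exists_between
  obtain ⟨ψ, hψ⟩ := KPOrbit.exists_isJacobianMap hB
  refine ⟨?_, hB.multiplierRing_eq, ?_⟩
  · rintro g hg hne ⟨h, hh⟩
    exact hne (hB.GammaMinus_eq_one hg h.2 hh)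
  -- The representatives in `Γ₊` are arbitrary and need not vary regularly: both sides of each
  -- comparison depend on `G (F t)` only through the point of the orbit and its class.
  · choose G hG using fun x : MulAction.orbit KPOrbit.GammaPlus W => x.2
    have hG' : ∀ x, G x • W = x.1 := hG
    let Φ := Equiv.ofBijective (fun x => ψ (G x)) ⟨fun x y hxy => Subtype.ext (by
        rw [← hG' x, ← hG' y]; exact (hψ.eq_iff _ _).1 hxy), fun y => by
      obtain ⟨g, rfl⟩ := hψ.surjective y
      exact ⟨⟨g • W, MulAction.mem_orbit W g⟩, (hψ.eq_iff _ _).2 (hG' _)⟩⟩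
    have hΦ : ∀ g : KPOrbit.GammaPlus, Φ ⟨g • W, MulAction.mem_orbit W g⟩ = ψ g := fun g =>
      (hψ.eq_iff _ _).2 (hG' _)
    refine ⟨Φ, fun g h => ?_, fun n T F => ?_, fun n T F _ => ?_⟩
    · rw [hΦ, hΦ, hΦ, hψ.class_mul]
    · have h1 := hψ.isRegular_iff hB hpos fun t => G (F t)
      simp only [hG'] at h1
      exact h1
    · have h1 := hψ.isHolomorphic_iff hB hpos fun t => G (F t)
      simp only [hG'] at h1
      exact h1
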